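/- Let $n\ge 1$, $0<\alpha<2$, and write $L^\infty=L^\infty(\mathbb R^n)$ (complex-valued functions; real-valued ones are included) and $[\,\cdot\,]$ for the integer part. For $f\in L^\infty$ and $t>0$ put $$W_tf(x)=e^{-t\Delta^2}f(x)=\int_{\mathbb R^n}W_t(x-y)f(y)\,dy,\qquad W_t(x)=(2\pi)^{-n}\int_{\mathbb R^n}e^{ix\cdot\xi-t|\xi|^4}\,d\xi,$$ $$e^{-t\sqrt{-\Delta}}f(x)=\int_{\mathbb R^n}P_t(x-y)f(y)\,dy,\qquad P_t(x)=\frac{\Gamma(\frac{n+1}2)}{\pi^{(n+1)/2}}\,\frac{t}{(t^2+|x|^2)^{(n+1)/2}}.$$ For a function $f$ on $\mathbb R^n$ the following three statements are equivalent: (1) $f\in L^\infty$ and there is a constant $C\ge 0$ such that $\|\partial_t^kW_tf\|_\infty\le C\,t^{-k+\alpha/4}$ for all $t>0$, where $k=[\alpha/4]+1=1$; (2) $f\in L^\infty$ and there is a constant $C\ge 0$ such that $\|\partial_t^k e^{-t\sqrt{-\Delta}}f\|_\infty\le C\,t^{-k+\alpha}$ for all $t>0$, where $k=[\alpha]+1$;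 (3) $f\in L^\infty$ and $\displaystyle N_\alpha[f]:=\sup_{|y|>0}\frac{\|f(\cdot+y)+f(\cdot-y)-2f(\cdot)\|_\infty}{|y|^\alpha}<\infty$. Moreover, let $S_\alpha[f]$ and $\tilde S_\alpha[f]$ be the infima of the constants $C$ admissible in (1) and in (2), respectively ($+\infty$ if there is none). Then $$\|f\|_\infty+S_\alpha[f]\;\sim\;\|f\|_\infty+\tilde S_\alpha[f]\;\sim\;\|f\|_\infty+N_\alpha[f]\qquad (f\in L^\infty),$$ where $A\sim B$ means $A\le KB$ and $B\le KA$ with a constant $K$ that depends only on $n$ and $\alpha$. -/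

import Mathlib

open MeasureTheory
open scoped FourierTransform ENNReal NNReal

noncomputable section

namespace BiharmonicLipschitz

/-- The biharmonic heat kernel `W_t(x) = (2π)⁻ⁿ ∫ exp(i x·ξ - t|ξ|⁴) dξ` of `e^{-tΔ²}`.
Mathlib's inverse Fourier transform is `∫ exp(2πi x·v) φ(v) dv`, so `ξ = 2πv`. -/
def biharmonicKernel {n : ℕ} (t : ℝ) : EuclideanSpace ℝ (Fin n) → ℂ :=
  𝓕⁻ (fun v : EuclideanSpace ℝ (Fin n) => (Real.exp (-t * (2 * Real.pi * ‖v‖) ^ 4) : ℂ))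

/-- `W_t f(x) = ∫ W_t(x - y) f(y) dy`. -/
def biharmonicHeat {n : ℕ} (f : EuclideanSpace ℝ (Fin n) → ℂ) (t : ℝ)
    (x : EuclideanSpace ℝ (Fin n)) : ℂ :=
  ∫ y, biharmonicKernel t (x - y) * f y

/-- The classical Poisson kernel
`P_t(x) = Γ((n+1)/2) π^{-(n+1)/2} t / (t² + |x|²)^{(n+1)/2}` of the upper half space. -/
def poissonKernel {n : ℕ} (t : ℝ) (x : EuclideanSpace ℝ (Fin n)) : ℝ :=
  Real.Gamma (((n : ℝ) + 1) / 2) / Real.pi ^ (((n : ℝ) + 1) / 2)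
    * (t / (t ^ 2 + ‖x‖ ^ 2) ^ (((n : ℝ) + 1) / 2))

/-- `e^{-t√(-Δ)} f(x) = ∫ P_t(x - y) f(y) dy`. -/
def poissonSemigroup {n : ℕ} (f : EuclideanSpace ℝ (Fin n) → ℂ) (t : ℝ)
    (x : EuclideanSpace ℝ (Fin n)) : ℂ :=
  ∫ y, (poissonKernel t (x - y) : ℂ) * f y

/-- `‖∂_t^k u(t, ·)‖_{L^∞} ≤ C t^{-k+γ}` for all `t > 0`.
It is used for the extensions above of a bounded `f`, which are smooth in `t > 0`. -/
def TimeDerivBound {n : ℕ} (u : ℝ → EuclideanSpace ℝ (Fin n) → ℂ) (k : ℕ) (γ : ℝ)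
    (C : ℝ≥0) : Prop :=
  ∀ t : ℝ, 0 < t →
    eLpNorm (fun x => iteratedDeriv k (fun s => u s x) t) ∞ volume
      ≤ ENNReal.ofReal ((C : ℝ) * t ^ (-(k : ℝ) + γ))

/-- The infimum of the admissible constants in `TimeDerivBound` (`∞` if there is none). -/
def bestConstant {n : ℕ} (u : ℝ → EuclideanSpace ℝ (Fin n) → ℂ) (k : ℕ) (γ : ℝ) : ℝ≥0∞ :=
  ⨅ (C : ℝ≥0) (_ : TimeDerivBound u k γ C), (C : ℝ≥0∞)

/-- The space `Λ_{α/4}^{Δ²}`. -/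
def biharmonicLipschitz (n : ℕ) (α : ℝ) : Set (EuclideanSpace ℝ (Fin n) → ℂ) :=
  {f | MemLp f ∞ volume ∧
    ∃ C : ℝ≥0, TimeDerivBound (biharmonicHeat f) (⌊α / 4⌋₊ + 1) (α / 4) C}

/-- `S_α[f]`. -/
def biharmonicSeminorm {n : ℕ} (α : ℝ) (f : EuclideanSpace ℝ (Fin n) → ℂ) : ℝ≥0∞ :=
  bestConstant (biharmonicHeat f) (⌊α / 4⌋₊ + 1) (α / 4)

/-- The bounded functions with `‖∂_t^k e^{-t√(-Δ)} f‖_∞ ≤ C t^{-k+α}`, `k = [α] + 1`. -/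
def poissonLipschitz (n : ℕ) (α : ℝ) : Set (EuclideanSpace ℝ (Fin n) → ℂ) :=
  {f | MemLp f ∞ volume ∧
    ∃ C : ℝ≥0, TimeDerivBound (poissonSemigroup f) (⌊α⌋₊ + 1) α C}

/-- `S̃_α[f]`. -/
def poissonSeminorm {n : ℕ} (α : ℝ) (f : EuclideanSpace ℝ (Fin n) → ℂ) : ℝ≥0∞ :=
  bestConstant (poissonSemigroup f) (⌊α⌋₊ + 1) α

/-- `N_α[f] = sup_{|y|>0} ‖f(· + y) + f(· - y) - 2 f‖_∞ / |y|^α`. -/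
def zygmundSeminorm {n : ℕ} (α : ℝ) (f : EuclideanSpace ℝ (Fin n) → ℂ) : ℝ≥0∞ :=
  ⨆ (y : EuclideanSpace ℝ (Fin n)) (_ : 0 < ‖y‖),
    eLpNorm (fun x => f (x + y) + f (x - y) - 2 * f x) ∞ volume / ENNReal.ofReal (‖y‖ ^ α)

/-- The bounded functions with `N_α[f] < ∞`. -/
def zygmundClass (n : ℕ) (α : ℝ) : Set (EuclideanSpace ℝ (Fin n) → ℂ) :=
  {f | MemLp f ∞ volume ∧ zygmundSeminorm α f < ∞}

/-- Nonnegative extended quantities `A`, `B` are comparable with constant `K`. -/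
def Comparable (K : ℝ≥0) (A B : ℝ≥0∞) : Prop :=
  A ≤ K * B ∧ B ≤ K * A

end BiharmonicLipschitz

end

/-! Both semigroups have the form exp(-t(-Δ)^{m/2}), with m = 4 and m = 1, and the argument uses
only what they share: even, decaying kernels t^{-d/m} ψ(t^{-1/m} x) with d the dimension, the
semigroup law, and second differences of ψ of L¹ norm O(|y|²). `IsSemigroupProfile` records this.
`bestConstant_comparable_zygmundSeminorm` compares the best constant of each semigroup with N_α, and
the theorem follows by passing through N_α.

From N_α to time derivatives (`ae_norm_kernelConv_le_of_secondDiff`): for k = 1, 2 the kernel of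
∂_t^k is even and has integral zero, so 2 ∂_t^k u(x) is its integral against f(x+z) + f(x-z) -
2f(x). Scaling gives t^{-k+α/m} as soon as |ψ_k(z)| |z|^α is integrable. For the Poisson kernel this
is where k = [α] + 1 is needed.

From time derivatives to N_α (`ae_norm_secondDiff_le_of_kernelConv`): by the semigroup law the bound
may be taken for k = 2, that is |u_tt| ≤ C t^{γ-2} with γ = α/m. Let D be the second difference of
step y in space, and τ = |y|^m. Then Du(ε) = [Du(ε) - 2Du(ε+τ) + Du(ε+2τ)] + 2Du(ε+τ) - Du(ε+2τ).
The bracket is a second difference in time and is O(τ^γ) = O(|y|^α). For the other terms, D is moved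
to the kernel at time t/2, so that Du_tt = O(|y|² t^{-2/m+γ-2}); two integrations from t = ∞ give
Du(t) = O(|y|² t^{-(2-α)/m}), which uses α < 2 and is O(|y|^α) for t ≥ τ. Finally ε tends to 0. -/

noncomputable section

namespace BiharmonicLipschitz

open Filter Topology Set

/-! ### Calculus estimates in one real variable -/

section OneVariable

/-- A function vanishing at infinity whose derivative is `O(s^{-p-1})` is `O(s^{-p})`. -/
lemma norm_le_of_deriv_decay {h h' : ℝ → ℂ} {A p : ℝ} (hp : 0 < p)
    (hd : ∀ s, 0 < s → HasDerivAt h (h' s) s) (hb : ∀ s, 0 < s → ‖h' s‖ ≤ A * s ^ (-p - 1))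
    (hl : Tendsto h atTop (𝓝 0)) {s : ℝ} (hs : 0 < s) : ‖h s‖ ≤ A / p * s ^ (-p) := by
  have hA : 0 ≤ A := by simpa using (norm_nonneg _).trans (hb 1 one_pos)
  have key : ∀ T, s ≤ T → ‖h T - h s‖ ≤ A / p * s ^ (-p) := by
    intro T hT
    have := image_norm_le_of_norm_deriv_right_le_deriv_boundary' (a := s) (b := T)
      (f := fun a => h a - h s) (f' := h') (B := fun a => A / p * (s ^ (-p) - a ^ (-p)))
      (B' := fun a => A * a ^ (-p - 1))
      (fun a ha => ((hd a (hs.trans_le ha.1)).sub_const _).continuousAt.continuousWithinAt)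
      (fun a ha => ((hd a (hs.trans_le ha.1)).sub_const _).hasDerivWithinAt)
      (by simp)
      (fun a ha => ContinuousAt.continuousWithinAt (by
        have : a ≠ 0 := (hs.trans_le ha.1).ne'
        exact continuousAt_const.mul (continuousAt_const.sub
          (Real.continuousAt_rpow_const _ _ (Or.inl this)))))
      (fun a ha => by
        have h1 := ((Real.hasDerivAt_rpow_const (x := a) (p := -p)
          (Or.inl (hs.trans_le ha.1).ne')).const_sub (s ^ (-p))).const_mul (A / p)
        refine (h1.congr_deriv ?_).hasDerivWithinAt
        field_simp)
      (fun a ha => hb a (hs.trans_le ha.1)) (right_mem_Icc.2 hT)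
    refine this.trans ?_
    have : 0 ≤ T ^ (-p) := Real.rpow_nonneg (hs.le.trans hT) _
    have : 0 ≤ A / p := by positivity
    gcongr
    linarith
  have hlim : Tendsto (fun T => ‖h T - h s‖) atTop (𝓝 ‖(0 : ℂ) - h s‖) :=
    (hl.sub_const _).norm
  rw [zero_sub, norm_neg] at hlim
  exact le_of_tendsto hlim ((eventually_ge_atTop s).mono key)

/-- Since γ > 0, the majorant s^{γ-1} has the antiderivative s^γ/γ, which vanishes at the origin;
hence a bound that does not depend on `a`. -/
lemma norm_sub_le_of_deriv_rpow {F F' : ℝ → ℂ} {M γ a b : ℝ} (hγ : 0 < γ) (ha : 0 < a)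
    (hab : a ≤ b) (hd : ∀ s ∈ Icc a b, HasDerivAt F (F' s) s)
    (hb : ∀ s ∈ Icc a b, ‖F' s‖ ≤ M * s ^ (γ - 1)) : ‖F b - F a‖ ≤ M / γ * b ^ γ := by
  have hM : 0 ≤ M := by
    have := (norm_nonneg _).trans (hb a (left_mem_Icc.2 hab))
    exact nonneg_of_mul_nonneg_left this (Real.rpow_pos_of_pos ha _)
  exact image_norm_le_of_norm_deriv_right_le_deriv_boundary' (a := a) (b := b)
      (f := fun s => F s - F a) (f' := F') (B := fun s => M / γ * s ^ γ)
      (B' := fun s => M * s ^ (γ - 1))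
      (fun s hs => ((hd s hs).sub_const _).continuousAt.continuousWithinAt)
      (fun s hs => ((hd s (Ico_subset_Icc_self hs)).sub_const _).hasDerivWithinAt)
      (by simp only [sub_self, norm_zero]; positivity)
      (fun s hs => ContinuousAt.continuousWithinAt
        (continuousAt_const.mul (Real.continuousAt_rpow_const _ _
          (Or.inl (ha.trans_le hs.1).ne'))))
      (fun s hs => by
        have h1 := (Real.hasDerivAt_rpow_const (x := s) (p := γ)
          (Or.inl (ha.trans_le hs.1).ne')).const_mul (M / γ)
        refine (h1.congr_deriv ?_).hasDerivWithinAt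
        field_simp)
      (fun s hs => hb s (Ico_subset_Icc_self hs)) (right_mem_Icc.2 hab)

/-- If `G'' = O(s^{γ-2})` near zero, the forward second difference of `G` of step `t` is
`O(t^γ)`, uniformly down to the origin. -/
lemma norm_forward_diff_two_le {G G' G'' : ℝ → ℂ} {M γ ε t : ℝ} (hγ : 0 < γ) (hε : 0 < ε)
    (hεt : ε ≤ t) (h1 : ∀ s, 0 < s → HasDerivAt G (G' s) s)
    (h2 : ∀ s, 0 < s → HasDerivAt G' (G'' s) s)
    (hb : ∀ s, 0 < s → ‖G'' s‖ ≤ M * s ^ (γ - 2)) :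
    ‖G ε - 2 * G (ε + t) + G (ε + 2 * t)‖ ≤ 2 * M / γ * (3 * t) ^ γ := by
  have ht : 0 < t := hε.trans_le hεt
  have hM : 0 ≤ M := by simpa using (norm_nonneg _).trans (hb 1 one_pos)
  have bd : ∀ s r : ℝ, 0 < s → |r| ≤ s → ‖(r : ℂ) * G'' s‖ ≤ M * s ^ (γ - 1) := by
    intro s r hs hr
    rw [norm_mul, Complex.norm_real, Real.norm_eq_abs]
    calc |r| * ‖G'' s‖ ≤ s * (M * s ^ (γ - 2)) :=
          mul_le_mul hr (hb s hs) (norm_nonneg _) hs.le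
      _ = M * s ^ (γ - 1) := by
          rw [show γ - 1 = (γ - 2) + 1 by ring, Real.rpow_add_one hs.ne']; ring
  -- Taylor's formula with integral remainder about the midpoint ε + t: the terms in G'(ε + t)
  -- cancel between `e1` and `e2`. The weights s - ε and ε + 2t - s are at most s, which turns
  -- s^{γ-2} into the integrable s^{γ-1}.
  have e1 := norm_sub_le_of_deriv_rpow (F := fun s => ((s - ε : ℝ) : ℂ) * G' s - G s)
    (F' := fun s => ((s - ε : ℝ) : ℂ) * G'' s) (M := M) hγ hε (b := ε + t) (by linarith)
    (fun s hs => by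
      have hs0 : 0 < s := hε.trans_le hs.1
      have := (((hasDerivAt_id s).sub_const ε).ofReal_comp.mul (h2 s hs0)).sub (h1 s hs0)
      refine this.congr_deriv ?_
      simp)
    (fun s hs => bd s _ (hε.trans_le hs.1) (by
      rw [abs_of_nonneg (by linarith [hs.1])]; linarith))
  have e2 := norm_sub_le_of_deriv_rpow
    (F := fun s => ((ε + 2 * t - s : ℝ) : ℂ) * G' s + G s)
    (F' := fun s => ((ε + 2 * t - s : ℝ) : ℂ) * G'' s) (M := M) hγ (a := ε + t)
    (b := ε + 2 * t) (by linarith) (by linarith)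
    (fun s hs => by
      have hs0 : 0 < s := by linarith [hs.1]
      have := (((hasDerivAt_id s).const_sub (ε + 2 * t)).ofReal_comp.mul (h2 s hs0)).add
        (h1 s hs0)
      refine this.congr_deriv ?_
      simp)
    (fun s hs => bd s _ (by linarith [hs.1]) (by
      rw [abs_of_nonneg (by linarith [hs.2])]; linarith [hs.1]))
  have b1 : (ε + t) ^ γ ≤ (3 * t) ^ γ := by
    apply Real.rpow_le_rpow <;> linarith
  have b2 : (ε + 2 * t) ^ γ ≤ (3 * t) ^ γ := by
    apply Real.rpow_le_rpow <;> linarith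
  have hMγ : 0 ≤ M / γ := by positivity
  have := norm_add_le_of_le (e1.trans (mul_le_mul_of_nonneg_left b1 hMγ))
    (e2.trans (mul_le_mul_of_nonneg_left b2 hMγ))
  refine (le_of_eq ?_).trans (this.trans (le_of_eq (by ring)))
  congr 1
  push_cast
  ring

/-- The central second difference is controlled by the second derivative. -/
lemma norm_central_diff_two_le {g g' g'' : ℝ → ℂ} {M : ℝ}
    (h1 : ∀ s ∈ Icc (-1 : ℝ) 1, HasDerivAt g (g' s) s)
    (h2 : ∀ s ∈ Icc (-1 : ℝ) 1, HasDerivAt g' (g'' s) s)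
    (hb : ∀ s ∈ Icc (-1 : ℝ) 1, ‖g'' s‖ ≤ M) : ‖g 1 + g (-1) - 2 * g 0‖ ≤ 2 * M := by
  have hM : 0 ≤ M := (norm_nonneg _).trans (hb 0 (by simp))
  have hneg : ∀ s ∈ Icc (0 : ℝ) 1, -s ∈ Icc (-1 : ℝ) 1 := fun s hs =>
    ⟨by linarith [hs.2], by linarith [hs.1]⟩
  have hpos : ∀ s ∈ Icc (0 : ℝ) 1, s ∈ Icc (-1 : ℝ) 1 := fun s hs =>
    ⟨by linarith [hs.1], hs.2⟩
  have key := (convex_Icc (0 : ℝ) 1).norm_image_sub_le_of_norm_hasDerivWithin_le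
    (f := fun s => g s + g (-s)) (f' := fun s => g' s - g' (-s)) (C := 2 * M)
    (fun s hs => by
      have a := h1 s (hpos s hs)
      have b := (h1 (-s) (hneg s hs)).scomp s (hasDerivAt_neg s)
      refine ((a.add b).congr_deriv ?_).hasDerivWithinAt
      simp [sub_eq_add_neg])
    (fun s hs => by
      have := (convex_Icc (-1 : ℝ) 1).norm_image_sub_le_of_norm_hasDerivWithin_le
        (fun r hr => (h2 r hr).hasDerivWithinAt) hb (hneg s hs) (hpos s hs)
      refine this.trans ?_
      have : ‖s - -s‖ ≤ 2 := by
        rw [Real.norm_eq_abs, abs_le]; constructor <;> linarith [hs.1, hs.2]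
      nlinarith)
    (left_mem_Icc.2 zero_le_one) (right_mem_Icc.2 zero_le_one)
  simp only [neg_zero, sub_zero, norm_one, mul_one] at key
  refine (le_of_eq ?_).trans key
  congr 1
  ring

end OneVariable

/-! ### Convolution of integrable kernels with bounded functions -/

section KernelConvolution

variable {E : Type*} [NormedAddCommGroup E] [InnerProductSpace ℝ E] [FiniteDimensional ℝ E]
  [MeasurableSpace E] [BorelSpace E]

/-- The convolution `∫ k(x - y) f(y) dy`. -/
def kernelConv (k f : E → ℂ) (x : E) : ℂ := ∫ y, k (x - y) * f y

/-- The symmetric second difference `f(x + y) + f(x - y) - 2 f(x)`. -/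
def secondDiff (y : E) (f : E → ℂ) (x : E) : ℂ := f (x + y) + f (x - y) - 2 * f x

variable {k k₁ k₂ f g : E → ℂ} {B : ℝ}

lemma integrable_kernelConv_integrand (hk : Integrable k) (hf : AEStronglyMeasurable f)
    (hB : ∀ᵐ y, ‖f y‖ ≤ B) (x : E) : Integrable (fun y => k (x - y) * f y) :=
  (hk.comp_sub_left x).mul_bdd hf hB

lemma norm_kernelConv_le (hk : Integrable k) (hB : ∀ᵐ y, ‖f y‖ ≤ B) (x : E) :
    ‖kernelConv k f x‖ ≤ (∫ y, ‖k y‖) * B := by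
  refine (norm_integral_le_of_norm_le ((hk.comp_sub_left x).norm.mul_const B) ?_).trans_eq ?_
  · filter_upwards [hB] with y hy
    rw [norm_mul]
    gcongr
  · rw [integral_mul_const, integral_sub_left_eq_self (fun y => ‖k y‖)]

lemma aestronglyMeasurable_kernelConv (hk : AEStronglyMeasurable k)
    (hf : AEStronglyMeasurable f) : AEStronglyMeasurable (kernelConv k f) := by
  have := (hf.convolution_integrand (ContinuousLinearMap.mul ℝ ℂ).flip hk).integral_prod_right'
  simp only [ContinuousLinearMap.flip_apply, ContinuousLinearMap.mul_apply'] at this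
  exact this

lemma kernelConv_kernel_comm (x : E) : kernelConv k₁ k₂ x = kernelConv k₂ k₁ x := by
  unfold kernelConv
  rw [← integral_sub_left_eq_self (fun y => k₂ (x - y) * k₁ y) volume x]
  simp [mul_comm]

/-- Fubini, the double integrand being an integrable function on the product times the bounded
factor f. -/
lemma kernelConv_assoc (h₁ : Integrable k₁) (h₂ : Integrable k₂)
    (hf : AEStronglyMeasurable f) (hB : ∀ᵐ y, ‖f y‖ ≤ B) (x : E) :
    kernelConv k₁ (kernelConv k₂ f) x = kernelConv (kernelConv k₁ k₂) f x := by
  have hint : Integrable (fun p : E × E => k₁ (x - p.1) * (k₂ (p.1 - p.2) * f p.2))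
      (volume.prod volume) := by
    have h := ((h₁.comp_sub_left x).convolution_integrand (ContinuousLinearMap.mul ℝ ℂ)
      h₂.comp_neg).swap
    have h' := h.mul_bdd (g := fun p : E × E => f p.2) (c := B) hf.comp_snd
      (Measure.quasiMeasurePreserving_snd.ae hB)
    refine h'.congr (ae_of_all _ fun p => ?_)
    simp [mul_assoc]
  unfold kernelConv
  simp_rw [← integral_const_mul]
  rw [integral_integral_swap hint]
  congr 1 with y
  rw [← integral_mul_const, ← integral_add_right_eq_self _ y]
  congr 1 with z
  rw [add_sub_cancel_right, sub_sub, add_comm z y]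
  ring

lemma kernelConv_comm (h₁ : Integrable k₁) (h₂ : Integrable k₂)
    (hf : AEStronglyMeasurable f) (hB : ∀ᵐ y, ‖f y‖ ≤ B) (x : E) :
    kernelConv k₁ (kernelConv k₂ f) x = kernelConv k₂ (kernelConv k₁ f) x := by
  rw [kernelConv_assoc h₁ h₂ hf hB, kernelConv_assoc h₂ h₁ hf hB,
    funext fun x => kernelConv_kernel_comm (k₁ := k₁) (k₂ := k₂) x]

lemma ae_comp_add_right {p : E → Prop} (h : ∀ᵐ x, p x) (y : E) : ∀ᵐ x, p (x + y) :=
  (measurePreserving_add_right volume y).quasiMeasurePreserving.ae h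

lemma aestronglyMeasurable_secondDiff (hf : AEStronglyMeasurable f) (y : E) :
    AEStronglyMeasurable (secondDiff y f) := by
  have h (y : E) : AEStronglyMeasurable (fun x => f (x + y)) :=
    hf.comp_quasiMeasurePreserving
      (measurePreserving_add_right volume y).quasiMeasurePreserving
  have h' := h (-y)
  simp only [← sub_eq_add_neg] at h'
  exact ((h y).add h').sub (hf.const_mul 2)

lemma ae_norm_secondDiff_le (hB : ∀ᵐ y, ‖f y‖ ≤ B) (y : E) :
    ∀ᵐ x, ‖secondDiff y f x‖ ≤ 4 * B := by
  filter_upwards [hB, ae_comp_add_right hB y, ae_comp_add_right hB (-y)] with x h1 h2 h3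
  rw [← sub_eq_add_neg] at h3
  calc ‖secondDiff y f x‖ ≤ ‖f (x + y)‖ + ‖f (x - y)‖ + ‖2 * f x‖ :=
        (norm_sub_le _ _).trans (by gcongr; exact norm_add_le _ _)
    _ ≤ 4 * B := by rw [norm_mul, Complex.norm_ofNat]; linarith

lemma integrable_secondDiff (hk : Integrable k) (y : E) : Integrable (secondDiff y k) :=
  ((hk.comp_add_right y).add (hk.comp_sub_right y)).sub (hk.const_mul 2)

/-- The difference may fall on the kernel, where smoothness yields a factor |y|², or on the datum as
in `secondDiff_kernelConv'`, where the limit t → 0 recovers the difference of f itself. -/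
lemma secondDiff_kernelConv (hk : Integrable k) (hf : AEStronglyMeasurable f)
    (hB : ∀ᵐ y, ‖f y‖ ≤ B) (y x : E) :
    secondDiff y (kernelConv k f) x = kernelConv (secondDiff y k) f x := by
  have h := integrable_kernelConv_integrand hk hf hB
  unfold secondDiff kernelConv
  rw [← integral_const_mul, ← integral_add (h _) (h _)]
  refine (integral_sub ((h _).add (h _)) ((h _).const_mul _)).symm.trans ?_
  congr 1 with z
  simp only [Pi.add_apply]
  rw [show x + y - z = x - z + y by abel, show x - y - z = x - z - y by abel]
  ring

lemma secondDiff_kernelConv' (hk : Integrable k) (hf : AEStronglyMeasurable f)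
    (hB : ∀ᵐ y, ‖f y‖ ≤ B) (y x : E) :
    secondDiff y (kernelConv k f) x = kernelConv k (secondDiff y f) x := by
  have h := integrable_kernelConv_integrand hk hf hB
  have h1 := (h (x + y)).comp_add_right y
  have h2 := (h (x - y)).comp_sub_right y
  simp only [add_sub_add_right_eq_sub, sub_sub_sub_cancel_right] at h1 h2
  unfold secondDiff kernelConv
  rw [← integral_add_right_eq_self (fun z => k (x + y - z) * f z) y,
    ← integral_sub_right_eq_self (fun z => k (x - y - z) * f z) y]
  simp only [add_sub_add_right_eq_sub, sub_sub_sub_cancel_right]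
  rw [← integral_const_mul, ← integral_add h1 h2]
  refine (integral_sub (h1.add h2) ((h x).const_mul _)).symm.trans ?_
  congr 1 with z
  simp only [Pi.add_apply]
  ring

end KernelConvolution

/-! ### Self-similar semigroup kernels -/

section Profile

variable {E : Type*} [NormedAddCommGroup E] [InnerProductSpace ℝ E] [FiniteDimensional ℝ E]
  [MeasurableSpace E] [BorelSpace E]

/-- The Fourier symbol `exp(-t (2π|v|)^m)` of the semigroup `exp(-t (-Δ)^{m/2})`. -/
def symbol (m : ℕ) (t : ℝ) (v : E) : ℂ := (Real.exp (-t * (2 * Real.pi * ‖v‖) ^ m) : ℂ)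

/-- The dilated kernels `t^{-(d/m+j)} ψ_j(t^{-1/m} x)`. -/
def dilatedKernel (m : ℕ) (ψ : ℕ → E → ℂ) (j : ℕ) (t : ℝ) (x : E) : ℂ :=
  ((t ^ (-((Module.finrank ℝ E : ℝ) / m + j)) : ℝ) : ℂ) * ψ j (t ^ (-(1 / (m : ℝ))) • x)

/-- Profiles `ψ 0, ψ 1, ψ 2` at time one of the kernel of `exp(-t (-Δ)^{m/2})` and of its first
two time derivatives. -/
structure IsSemigroupProfile (m : ℕ) (ψ : ℕ → E → ℂ) : Prop where
  order_pos : 0 < m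
  continuous : ∀ j ≤ 2, Continuous (ψ j)
  -- The exponent is the decay rate of the Poisson kernel, the slower of the two.
  decay : ∃ C, ∀ j ≤ 2, ∀ z, ‖ψ j z‖ ≤ C * (1 + ‖z‖) ^ (-((Module.finrank ℝ E : ℝ) + 1))
  even : ∀ j ≤ 2, ∀ z, ψ j (-z) = ψ j z
  -- The time derivative at t = 1 of t^{-(d/m+j)} ψ_j(t^{-1/m} z), where D is the radial derivative
  -- z · ∇ψ_j(z).
  euler : ∀ j < 2, ∀ z, ∃ D, HasDerivAt (fun r : ℝ => ψ j (r • z)) D 1 ∧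
    ψ (j + 1) z = -((Module.finrank ℝ E : ℂ) / m + j) * ψ j z - 1 / m * D
  fourierInv_symbol : ψ 0 = 𝓕⁻ (symbol (E := E) m 1)
  integral_secondDiff_le : ∃ C, ∀ y, ∫ x, ‖secondDiff y (ψ 0) x‖ ≤ C * ‖y‖ ^ 2

omit [InnerProductSpace ℝ E] [FiniteDimensional ℝ E] [MeasurableSpace E] [BorelSpace E] in
lemma continuous_symbol (m : ℕ) (t : ℝ) : Continuous (symbol (E := E) m t) := by
  unfold symbol
  fun_prop

/-- From y^N / N! ≤ e^y with y = c r^m. The explicit constant serves both the integrability of the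
symbol and its Schwartz decay. -/
lemma one_add_pow_le_exp {c : ℝ} (hc : 0 < c) {m : ℕ} (hm : 0 < m) (N : ℕ) {r : ℝ}
    (hr : 0 ≤ r) : (1 + r) ^ N ≤ 2 ^ N * (1 + N.factorial / c ^ N) * Real.exp (c * r ^ m) := by
  set y := c * r ^ m with hy
  have hy0 : 0 ≤ y := by positivity
  have h1 : y ^ N / N.factorial ≤ Real.exp y := Real.pow_div_factorial_le_exp y hy0 N
  have h2 : 1 ≤ Real.exp y := Real.one_le_exp hy0
  have h3 : (1 + r) ^ N ≤ 2 ^ N * (1 + (r ^ m) ^ N) := by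
    rcases le_total r 1 with h | h
    · calc (1 + r) ^ N ≤ 2 ^ N := by gcongr; linarith
        _ ≤ _ := le_mul_of_one_le_right (by positivity) (by simp; positivity)
    · calc (1 + r) ^ N ≤ (2 * r) ^ N := by gcongr; linarith
        _ = 2 ^ N * r ^ N := mul_pow _ _ _
        _ ≤ 2 ^ N * (1 + (r ^ m) ^ N) := by
          gcongr
          have : r ≤ r ^ m := le_self_pow₀ h hm.ne'
          have : r ^ N ≤ (r ^ m) ^ N := by gcongr
          linarith
  have h4 : (r ^ m) ^ N ≤ N.factorial / c ^ N * Real.exp y := by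
    rw [div_mul_eq_mul_div, le_div_iff₀ (by positivity), ← mul_pow, mul_comm (r ^ m),
      ← hy]
    rwa [div_le_iff₀' (by positivity)] at h1
  calc (1 + r) ^ N ≤ 2 ^ N * (1 + (r ^ m) ^ N) := h3
    _ ≤ 2 ^ N * (Real.exp y + N.factorial / c ^ N * Real.exp y) := by gcongr
    _ = _ := by ring

lemma integrable_symbol {m : ℕ} (hm : 0 < m) {t : ℝ} (ht : 0 < t) :
    Integrable (symbol (E := E) m t) := by
  set N := Module.finrank ℝ E + 1 with hN
  set c := t * (2 * Real.pi) ^ m with hc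
  have hc0 : 0 < c := by positivity
  have hint : Integrable (fun v : E => (2 : ℝ) ^ N * (1 + N.factorial / c ^ N) *
      (1 + ‖v‖) ^ (-(N : ℝ))) :=
    (integrable_one_add_norm (by rw [hN]; push_cast; linarith)).const_mul _
  refine hint.mono' (continuous_symbol m t).aestronglyMeasurable (ae_of_all _ fun v => ?_)
  have e1 : ‖symbol m t v‖ = Real.exp (-(c * ‖v‖ ^ m)) := by
    rw [symbol, Complex.norm_real, Real.norm_of_nonneg (Real.exp_pos _).le, hc, mul_pow]
    congr 1
    ring
  rw [e1, Real.rpow_neg (by positivity), Real.rpow_natCast, Real.exp_neg, ← div_eq_mul_inv,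
    inv_le_comm₀ (Real.exp_pos _) (by positivity), inv_div, div_le_iff₀ (by positivity),
    mul_comm (Real.exp _)]
  exact one_add_pow_le_exp hc0 hm N (norm_nonneg v)

lemma integral_comp_dilation {F : Type*} [NormedAddCommGroup F] [NormedSpace ℝ F] {m : ℕ}
    {t : ℝ} (ht : 0 < t) (g : E → F) :
    ∫ x, g (t ^ (-(1 / (m : ℝ))) • x) = t ^ ((Module.finrank ℝ E : ℝ) / m) • ∫ x, g x := by
  rw [Measure.integral_comp_smul_of_nonneg _ _ _ (hR := Real.rpow_nonneg ht.le _),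
    ← Real.rpow_natCast, ← Real.rpow_mul ht.le, ← Real.rpow_neg ht.le]
  congr 2
  ring

lemma fourierInv_symbol_dilation {m : ℕ} (hm : 0 < m) {t : ℝ} (ht : 0 < t) (x : E) :
    𝓕⁻ (symbol (E := E) m t) x = ((t ^ (-((Module.finrank ℝ E : ℝ) / m)) : ℝ) : ℂ) *
      𝓕⁻ (symbol (E := E) m 1) (t ^ (-(1 / (m : ℝ))) • x) := by
  set κ := t ^ (-(1 / (m : ℝ))) with hκ
  have hκ0 : 0 < κ := Real.rpow_pos_of_pos ht _
  have hκm : κ ^ m = t⁻¹ := by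
    rw [hκ, ← Real.rpow_natCast, ← Real.rpow_mul ht.le, ← Real.rpow_neg_one]
    congr 1
    field_simp
  have key := integral_comp_dilation (E := E) (m := m) ht
    (fun v => Complex.exp (((2 * Real.pi * inner ℝ v x : ℝ) : ℂ) * Complex.I) • symbol m t v)
  rw [Real.fourierInv_eq', Real.fourierInv_eq']
  have e : ∀ v : E, Complex.exp (((2 * Real.pi * inner ℝ v (κ • x) : ℝ) : ℂ) * Complex.I) •
      symbol m 1 v = Complex.exp (((2 * Real.pi * inner ℝ (κ • v) x : ℝ) : ℂ) * Complex.I) •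
      symbol m t (κ • v) := by
    intro v
    have hs : symbol m 1 v = symbol m t (κ • v) := by
      rw [symbol, symbol, norm_smul, Real.norm_of_nonneg hκ0.le,
        show 2 * Real.pi * (κ * ‖v‖) = κ * (2 * Real.pi * ‖v‖) by ring, mul_pow κ, hκm]
      congr 2
      field_simp
    rw [hs, inner_smul_left, inner_smul_right]
    simp
  simp_rw [e]
  rw [key, Complex.real_smul, ← mul_assoc, ← Complex.ofReal_mul, ← Real.rpow_add ht,
    neg_add_cancel, Real.rpow_zero, Complex.ofReal_one, one_mul]

namespace IsSemigroupProfile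

variable {m : ℕ} {ψ : ℕ → E → ℂ}

lemma integrable_profile (hψ : IsSemigroupProfile m ψ) {j : ℕ} (hj : j ≤ 2) :
    Integrable (ψ j) := by
  obtain ⟨C, hC⟩ := hψ.decay
  exact ((integrable_one_add_norm (by linarith)).const_mul C).mono'
    (hψ.continuous j hj).aestronglyMeasurable (ae_of_all _ (hC j hj))

lemma continuous_kernel (hψ : IsSemigroupProfile m ψ) {j : ℕ} (hj : j ≤ 2) (t : ℝ) :
    Continuous (dilatedKernel m ψ j t) :=
  continuous_const.mul ((hψ.continuous j hj).comp (continuous_const_smul _))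

lemma integrable_kernel (hψ : IsSemigroupProfile m ψ) {j : ℕ} (hj : j ≤ 2) {t : ℝ}
    (ht : 0 < t) : Integrable (dilatedKernel m ψ j t) :=
  ((hψ.integrable_profile hj).comp_smul (Real.rpow_pos_of_pos ht _).ne').const_mul _

lemma kernel_even (hψ : IsSemigroupProfile m ψ) {j : ℕ} (hj : j ≤ 2) (t : ℝ) (x : E) :
    dilatedKernel m ψ j t (-x) = dilatedKernel m ψ j t x := by
  rw [dilatedKernel, dilatedKernel, smul_neg, hψ.even j hj]

omit [FiniteDimensional ℝ E] [MeasurableSpace E] [BorelSpace E] in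
lemma norm_kernel_mul_rpow (j : ℕ) {t : ℝ} (ht : 0 < t) (α : ℝ) (x : E) :
    ‖dilatedKernel m ψ j t x‖ * ‖x‖ ^ α =
      t ^ (-((Module.finrank ℝ E : ℝ) / m + j) + α / m) *
      (‖ψ j (t ^ (-(1 / (m : ℝ))) • x)‖ * ‖t ^ (-(1 / (m : ℝ))) • x‖ ^ α) := by
  have hκ := Real.rpow_pos_of_pos ht (-(1 / (m : ℝ)))
  rw [dilatedKernel, norm_mul, Complex.norm_real,
    Real.norm_of_nonneg (Real.rpow_nonneg ht.le _), norm_smul, Real.norm_of_nonneg hκ.le,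
    Real.mul_rpow hκ.le (norm_nonneg _), ← Real.rpow_mul ht.le, Real.rpow_add ht _ (α / m)]
  have : t ^ (α / m) * t ^ (-(1 / (m : ℝ)) * α) = 1 := by
    rw [← Real.rpow_add ht]
    convert Real.rpow_zero t using 2
    ring
  linear_combination (-(t ^ (-((Module.finrank ℝ E : ℝ) / m + j)) *
    ‖ψ j (t ^ (-(1 / (m : ℝ))) • x)‖ * ‖x‖ ^ α)) * this

lemma integral_norm_kernel_mul_rpow (j : ℕ) {t : ℝ} (ht : 0 < t) (α : ℝ) :
    ∫ x, ‖dilatedKernel m ψ j t x‖ * ‖x‖ ^ α =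
      t ^ (-(j : ℝ) + α / m) * ∫ z, ‖ψ j z‖ * ‖z‖ ^ α := by
  have key := integral_comp_dilation (E := E) (m := m) ht (fun z => ‖ψ j z‖ * ‖z‖ ^ α)
  simp_rw [norm_kernel_mul_rpow j ht α]
  rw [integral_const_mul, key, smul_eq_mul, ← mul_assoc, ← Real.rpow_add ht]
  congr 2
  ring

lemma integrable_norm_kernel_mul_rpow {j : ℕ} {t : ℝ} (ht : 0 < t) {α : ℝ}
    (h : Integrable (fun z => ‖ψ j z‖ * ‖z‖ ^ α)) :
    Integrable (fun x => ‖dilatedKernel m ψ j t x‖ * ‖x‖ ^ α) := by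
  simp_rw [norm_kernel_mul_rpow j ht α]
  exact (h.comp_smul (Real.rpow_pos_of_pos ht _).ne').const_mul _

lemma integral_norm_kernel (j : ℕ) {t : ℝ} (ht : 0 < t) :
    ∫ x, ‖dilatedKernel m ψ j t x‖ = t ^ (-(j : ℝ)) * ∫ z, ‖ψ j z‖ := by
  simpa using integral_norm_kernel_mul_rpow (m := m) (ψ := ψ) j ht 0

/-- The relation `euler` at time one, transported to time t by scaling. -/
lemma hasDerivAt_kernel (hψ : IsSemigroupProfile m ψ) {j : ℕ} (hj : j < 2) {t : ℝ}
    (ht : 0 < t) (x : E) :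
    HasDerivAt (fun s => dilatedKernel m ψ j s x) (dilatedKernel m ψ (j + 1) t x) t := by
  set κ : ℝ := 1 / m with hκ
  set a : ℝ := (Module.finrank ℝ E : ℝ) / m + j with ha
  set z := t ^ (-κ) • x with hz
  obtain ⟨D, hD, hD'⟩ := hψ.euler j hj z
  -- The ratio of dilation factors at times s and t equals 1 at s = t, so the radial derivative at r
  -- = 1 applies.
  have hr : HasDerivAt (fun s : ℝ => s ^ (-κ) * t ^ κ) (-κ / t) t := by
    refine ((Real.hasDerivAt_rpow_const (p := -κ) (Or.inl ht.ne')).mul_const _).congr_deriv ?_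
    rw [mul_assoc, ← Real.rpow_add ht, show -κ - 1 + κ = -1 by ring, Real.rpow_neg_one,
      div_eq_mul_inv]
  have hr1 : t ^ (-κ) * t ^ κ = 1 := by rw [← Real.rpow_add ht]; simp
  have hrs : ∀ s : ℝ, (s ^ (-κ) * t ^ κ) • z = s ^ (-κ) • x := fun s => by
    rw [hz, smul_smul, mul_assoc, mul_comm (t ^ κ), hr1, mul_one]
  have hcomp : HasDerivAt (fun s : ℝ => ψ j (s ^ (-κ) • x)) ((-κ / t : ℝ) • D) t := by
    rw [← hr1] at hD
    have := hD.scomp t hr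
    simpa only [Function.comp_def, hrs] using this
  have hpow : HasDerivAt (fun s : ℝ => ((s ^ (-a) : ℝ) : ℂ)) ((-a * t ^ (-a - 1) : ℝ) : ℂ) t :=
    (Real.hasDerivAt_rpow_const (Or.inl ht.ne')).ofReal_comp
  refine (hpow.mul hcomp).congr_deriv ?_
  have e1 : t ^ (-a - 1) = t ^ (-a) / t := Real.rpow_sub_one ht.ne' _
  have e2 : -((Module.finrank ℝ E : ℝ) / m + ((j + 1 : ℕ) : ℝ)) = -a - 1 := by
    rw [ha]; push_cast; ring
  rw [dilatedKernel, e2, e1, ← hκ, ← hz, hD', Complex.real_smul, ha, hκ]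
  push_cast
  have : (t : ℂ) ≠ 0 := by exact_mod_cast ht.ne'
  field_simp
  ring

/-- The domination needed to differentiate under the integral. On the time interval the prefactor is
largest at t₀/2 and the dilated argument is smallest at 2t₀; `A` adds the prefactors of the three
indices. -/
lemma exists_kernel_bound (hψ : IsSemigroupProfile m ψ) {t₀ : ℝ} (ht₀ : 0 < t₀) :
    ∃ b : E → ℝ, Integrable b ∧
      ∀ j ≤ 2, ∀ t ∈ Ioo (t₀ / 2) (2 * t₀), ∀ x, ‖dilatedKernel m ψ j t x‖ ≤ b x := by
  obtain ⟨C, hC⟩ := hψ.decay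
  set d : ℝ := (Module.finrank ℝ E : ℝ) with hd
  have hC0 : 0 ≤ C := by
    simpa using (norm_nonneg _).trans (hC 0 (by norm_num) 0)
  set A := (t₀ / 2) ^ (-(d / m + (0 : ℕ))) + (t₀ / 2) ^ (-(d / m + (1 : ℕ))) +
    (t₀ / 2) ^ (-(d / m + (2 : ℕ))) with hA
  have hκ := Real.rpow_pos_of_pos (mul_pos two_pos ht₀) (-(1 / (m : ℝ)))
  refine ⟨fun x => A * (C * (1 + ‖(2 * t₀) ^ (-(1 / (m : ℝ))) • x‖) ^ (-(d + 1))),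
    Integrable.const_mul (((integrable_one_add_norm (by linarith)).const_mul C).comp_smul
      hκ.ne') _, ?_⟩
  intro j hj t ht x
  have ht0 : 0 < t := by linarith [ht.1]
  have hm : (0 : ℝ) < m := by exact_mod_cast hψ.order_pos
  rw [dilatedKernel, norm_mul, Complex.norm_real,
    Real.norm_of_nonneg (Real.rpow_nonneg ht0.le _)]
  have h1 : t ^ (-(d / m + j)) ≤ A := by
    have : t ^ (-(d / m + j)) ≤ (t₀ / 2) ^ (-(d / m + j)) :=
      Real.rpow_le_rpow_of_nonpos (by positivity) ht.1.le (by
        have : 0 ≤ d := by positivity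
        have : 0 ≤ d / m + j := by positivity
        linarith)
    refine this.trans ?_
    have hp : ∀ i : ℕ, 0 ≤ (t₀ / 2) ^ (-(d / m + i)) := fun i => by positivity
    have := hp 0; have := hp 1; have := hp 2
    interval_cases j <;> rw [hA] <;> linarith
  have h2 : ‖ψ j (t ^ (-(1 / (m : ℝ))) • x)‖ ≤
      C * (1 + ‖(2 * t₀) ^ (-(1 / (m : ℝ))) • x‖) ^ (-(d + 1)) := by
    refine (hC j hj _).trans (mul_le_mul_of_nonneg_left ?_ hC0)
    refine Real.rpow_le_rpow_of_nonpos (by positivity) ?_ (by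
      have : 0 ≤ d := by positivity
      linarith)
    rw [norm_smul, norm_smul, Real.norm_of_nonneg hκ.le,
      Real.norm_of_nonneg (Real.rpow_nonneg ht0.le _)]
    gcongr 1 + ?_ * _
    exact Real.rpow_le_rpow_of_nonpos ht0 ht.2.le (by
      have : 0 < 1 / (m : ℝ) := by positivity
      linarith)
  exact mul_le_mul h1 h2 (norm_nonneg _) ((Real.rpow_nonneg ht0.le _).trans h1)

lemma hasDerivAt_kernelConv (hψ : IsSemigroupProfile m ψ) {j : ℕ} (hj : j < 2) {f : E → ℂ}
    {B : ℝ} (hf : AEStronglyMeasurable f) (hB : ∀ᵐ y, ‖f y‖ ≤ B) {t : ℝ} (ht : 0 < t) (x : E) :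
    HasDerivAt (fun s => kernelConv (dilatedKernel m ψ j s) f x)
      (kernelConv (dilatedKernel m ψ (j + 1) t) f x) t := by
  obtain ⟨b, hb, hbK⟩ := hψ.exists_kernel_bound ht
  have hmeas : ∀ i ≤ 2, ∀ s,
      AEStronglyMeasurable (fun y => dilatedKernel m ψ i s (x - y) * f y) := fun i hi s =>
    ((hψ.continuous_kernel hi s).comp (continuous_const.sub
      continuous_id)).aestronglyMeasurable.mul hf
  refine (hasDerivAt_integral_of_dominated_loc_of_deriv_le (𝕜 := ℝ)
    (F := fun s y => dilatedKernel m ψ j s (x - y) * f y)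
    (F' := fun s y => dilatedKernel m ψ (j + 1) s (x - y) * f y)
    (bound := fun y => b (x - y) * B) (s := Ioo (t / 2) (2 * t))
    (Ioo_mem_nhds (by linarith) (by linarith)) (Eventually.of_forall fun s => hmeas j hj.le s)
    (integrable_kernelConv_integrand (hψ.integrable_kernel hj.le ht) hf hB x)
    (hmeas (j + 1) hj t) ?_ ((hb.comp_sub_left x).mul_const B) ?_).2
  · filter_upwards [hB] with y hy s hs
    rw [norm_mul]
    have := hbK (j + 1) hj s hs (x - y)
    exact mul_le_mul this hy (norm_nonneg _) ((norm_nonneg _).trans this)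
  · refine ae_of_all _ fun y s hs => ?_
    exact (hψ.hasDerivAt_kernel hj (by linarith [hs.1]) _).mul_const _

lemma kernel_zero_eq (hψ : IsSemigroupProfile m ψ) {t : ℝ} (ht : 0 < t) :
    dilatedKernel m ψ 0 t = 𝓕⁻ (symbol (E := E) m t) := by
  ext x
  rw [fourierInv_symbol_dilation hψ.order_pos ht, ← hψ.fourierInv_symbol, dilatedKernel]
  simp

lemma fourier_kernel_zero (hψ : IsSemigroupProfile m ψ) {t : ℝ} (ht : 0 < t) :
    𝓕 (dilatedKernel m ψ 0 t) = symbol (E := E) m t := by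
  have h := hψ.kernel_zero_eq ht
  have hint := hψ.integrable_kernel (j := 0) (by norm_num) ht
  rw [h] at hint ⊢
  refine (continuous_symbol m t).fourier_fourierInv_eq (integrable_symbol hψ.order_pos ht) ?_
  have := hint.comp_neg
  simpa [Real.fourierInv_eq_fourier_neg] using this

lemma integral_kernel_zero (hψ : IsSemigroupProfile m ψ) {t : ℝ} (ht : 0 < t) :
    ∫ x, dilatedKernel m ψ 0 t x = 1 := by
  have h := congrFun (hψ.fourier_kernel_zero ht) 0
  rw [Real.fourier_eq] at h
  simpa [symbol, hψ.order_pos.ne'] using h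

/-- The kernels form a convolution semigroup. -/
lemma kernelConv_kernel_zero (hψ : IsSemigroupProfile m ψ) {s t : ℝ} (hs : 0 < s)
    (ht : 0 < t) : kernelConv (dilatedKernel m ψ 0 s) (dilatedKernel m ψ 0 t) =
      dilatedKernel m ψ 0 (s + t) := by
  have hks := hψ.integrable_kernel (j := 0) (by norm_num) hs
  have hkt := hψ.integrable_kernel (j := 0) (by norm_num) ht
  set Φ := convolution (dilatedKernel m ψ 0 s) (dilatedKernel m ψ 0 t)
    (ContinuousLinearMap.mul ℂ ℂ) volume with hΦ
  have e : kernelConv (dilatedKernel m ψ 0 s) (dilatedKernel m ψ 0 t) = Φ := by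
    ext x
    rw [hΦ, convolution_mul_swap]
    rfl
  -- Continuity makes Fourier inversion a pointwise identity, so the two kernels agree everywhere.
  have hcont : Continuous Φ := by
    refine BddAbove.continuous_convolution_right_of_integrable _ ?_ hks
      (hψ.continuous_kernel (by norm_num) t)
    obtain ⟨C, hC⟩ := hψ.decay
    have hC0 : 0 ≤ C := by simpa using (norm_nonneg _).trans (hC 0 (by norm_num) 0)
    refine ⟨t ^ (-((Module.finrank ℝ E : ℝ) / m + (0 : ℕ))) * C, ?_⟩
    rintro _ ⟨x, rfl⟩
    simp only [dilatedKernel, norm_mul, Complex.norm_real,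
      Real.norm_of_nonneg (Real.rpow_nonneg ht.le _)]
    gcongr
    refine (hC 0 (by norm_num) _).trans (mul_le_of_le_one_right hC0 ?_)
    refine Real.rpow_le_one_of_one_le_of_nonpos (by simp) ?_
    have : (0 : ℝ) ≤ Module.finrank ℝ E := by positivity
    linarith
  have hint : Integrable Φ := hks.integrable_convolution _ hkt
  have hF : 𝓕 Φ = symbol (E := E) m (s + t) := by
    ext ξ
    rw [hΦ, Real.fourier_mul_convolution_eq hks hkt, hψ.fourier_kernel_zero hs,
      hψ.fourier_kernel_zero ht, symbol, symbol, symbol, ← Complex.ofReal_mul, ← Real.exp_add]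
    congr 2
    ring
  rw [e, hψ.kernel_zero_eq (add_pos hs ht), ← hF, hcont.fourierInv_fourier_eq hint]
  rw [hF]
  exact integrable_symbol hψ.order_pos (add_pos hs ht)

/-- The total mass of the kernel is constantly 1 in t; its time derivatives are obtained by
convolving with the constant function 1. -/
lemma integral_kernel_eq_zero (hψ : IsSemigroupProfile m ψ) {j : ℕ} (hj : j = 1 ∨ j = 2)
    {t : ℝ} (ht : 0 < t) : ∫ x, dilatedKernel m ψ j t x = 0 := by
  have e : ∀ i s, kernelConv (dilatedKernel m ψ i s) (fun _ => 1) 0 =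
      ∫ x, dilatedKernel m ψ i s x := fun i s => by
    simp only [kernelConv, mul_one]
    exact integral_sub_left_eq_self _ volume 0
  have hd : ∀ i < 2, ∀ s : ℝ, 0 < s → HasDerivAt (fun r => ∫ x, dilatedKernel m ψ i r x)
      (∫ x, dilatedKernel m ψ (i + 1) s x) s := fun i hi s hs => by
    have := hψ.hasDerivAt_kernelConv hi (f := fun _ => 1) (B := 1)
      aestronglyMeasurable_const (by simp) hs 0
    simpa only [e] using this
  have step : ∀ i < 2, ∀ c : ℂ, (∀ s : ℝ, 0 < s → ∫ x, dilatedKernel m ψ i s x = c) →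
      ∀ s : ℝ, 0 < s → ∫ x, dilatedKernel m ψ (i + 1) s x = 0 := fun i hi c hc s hs => by
    refine (hd i hi s hs).unique ((hasDerivAt_const s c).congr_of_eventuallyEq ?_)
    filter_upwards [lt_mem_nhds hs] with r hr using hc r hr
  have h1 := step 0 (by norm_num) 1 (fun s hs => hψ.integral_kernel_zero hs)
  rcases hj with rfl | rfl
  · exact h1 t ht
  · exact step 1 (by norm_num) 0 h1 t ht

lemma integral_norm_secondDiff_kernel (hψ : IsSemigroupProfile m ψ) : ∃ C, 0 ≤ C ∧
    ∀ t, 0 < t → ∀ y, ∫ x, ‖secondDiff y (dilatedKernel m ψ 0 t) x‖ ≤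
      C * t ^ (-(2 / (m : ℝ))) * ‖y‖ ^ 2 := by
  obtain ⟨C, hC⟩ := hψ.integral_secondDiff_le
  refine ⟨max C 0, le_max_right _ _, fun t ht y => ?_⟩
  set κ := t ^ (-(1 / (m : ℝ))) with hκ
  have hκ0 : 0 < κ := Real.rpow_pos_of_pos ht _
  have e : ∀ x, ‖secondDiff y (dilatedKernel m ψ 0 t) x‖ =
      t ^ (-((Module.finrank ℝ E : ℝ) / m)) * ‖secondDiff (κ • y) (ψ 0) (κ • x)‖ := fun x => by
    rw [← Real.norm_of_nonneg (Real.rpow_nonneg ht.le (-((Module.finrank ℝ E : ℝ) / m))),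
      ← Complex.norm_real, ← norm_mul]
    simp only [secondDiff, dilatedKernel, smul_add, smul_sub, ← hκ]
    congr 1
    simp
    ring
  simp_rw [e]
  rw [integral_const_mul, integral_comp_dilation ht (fun x => ‖secondDiff (κ • y) (ψ 0) x‖),
    smul_eq_mul, ← mul_assoc, ← Real.rpow_add ht, neg_add_cancel, Real.rpow_zero, one_mul]
  refine (hC _).trans ?_
  have e2 : κ ^ 2 = t ^ (-(2 / (m : ℝ))) := by
    rw [hκ, ← Real.rpow_natCast, ← Real.rpow_mul ht.le]
    congr 1
    push_cast
    ring
  rw [norm_smul, Real.norm_of_nonneg hκ0.le, mul_pow, e2, mul_assoc]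
  gcongr
  exact le_max_left _ _

end IsSemigroupProfile

end Profile

/-! ### Time derivatives of the semigroup and second differences -/

namespace IsSemigroupProfile

variable {E : Type*} [NormedAddCommGroup E] [InnerProductSpace ℝ E] [FiniteDimensional ℝ E]
  [MeasurableSpace E] [BorelSpace E] {m : ℕ} {ψ : ℕ → E → ℂ} {f : E → ℂ} {B : ℝ}

lemma kernelConv_kernelConv_zero (hψ : IsSemigroupProfile m ψ) (hf : AEStronglyMeasurable f)
    (hB : ∀ᵐ y, ‖f y‖ ≤ B) {s t : ℝ} (hs : 0 < s) (ht : 0 < t) (x : E) :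
    kernelConv (dilatedKernel m ψ 0 s) (kernelConv (dilatedKernel m ψ 0 t) f) x =
      kernelConv (dilatedKernel m ψ 0 (s + t)) f x := by
  rw [kernelConv_assoc (hψ.integrable_kernel (by norm_num) hs)
    (hψ.integrable_kernel (by norm_num) ht) hf hB, hψ.kernelConv_kernel_zero hs ht]

lemma aestronglyMeasurable_kernelConv (hψ : IsSemigroupProfile m ψ)
    (hf : AEStronglyMeasurable f) {j : ℕ} (hj : j ≤ 2) (t : ℝ) :
    AEStronglyMeasurable (kernelConv (dilatedKernel m ψ j t) f) :=
  BiharmonicLipschitz.aestronglyMeasurable_kernelConv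
    (hψ.continuous_kernel hj t).aestronglyMeasurable hf

lemma norm_kernelConv_le (hψ : IsSemigroupProfile m ψ) (hB : ∀ᵐ y, ‖f y‖ ≤ B) {j : ℕ}
    (hj : j ≤ 2) {t : ℝ} (ht : 0 < t) (x : E) :
    ‖kernelConv (dilatedKernel m ψ j t) f x‖ ≤ t ^ (-(j : ℝ)) * (∫ z, ‖ψ j z‖) * B := by
  rw [← integral_norm_kernel (m := m) j ht]
  exact BiharmonicLipschitz.norm_kernelConv_le (hψ.integrable_kernel hj ht) hB x

lemma hasDerivAt_comp_const_add {F : ℝ → ℂ} {F' : ℂ} {s t : ℝ} (h : HasDerivAt F F' (s + t)) :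
    HasDerivAt (fun r => F (s + r)) F' t := by
  simpa using h.comp_const_add s t

/-- Differentiate the semigroup law in t. The kernels are commuted beforehand so that the one
depending on t stands outside, acting on a fixed bounded function. -/
lemma kernelConv_zero_kernelConv (hψ : IsSemigroupProfile m ψ) (hf : AEStronglyMeasurable f)
    (hB : ∀ᵐ y, ‖f y‖ ≤ B) {j : ℕ} (hj : j ≤ 2) {s t : ℝ} (hs : 0 < s) (ht : 0 < t) (x : E) :
    kernelConv (dilatedKernel m ψ 0 s) (kernelConv (dilatedKernel m ψ j t) f) x =
      kernelConv (dilatedKernel m ψ j (s + t)) f x := by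
  induction j generalizing t with
  | zero => exact hψ.kernelConv_kernelConv_zero hf hB hs ht x
  | succ j ih =>
    have hj' : j < 2 := hj
    have hcomm : ∀ i ≤ 2, ∀ r, 0 < r →
        kernelConv (dilatedKernel m ψ 0 s) (kernelConv (dilatedKernel m ψ i r) f) x =
        kernelConv (dilatedKernel m ψ i r) (kernelConv (dilatedKernel m ψ 0 s) f) x :=
      fun i hi r hr => kernelConv_comm (hψ.integrable_kernel (by norm_num) hs)
        (hψ.integrable_kernel hi hr) hf hB x
    have h1 := hψ.hasDerivAt_kernelConv hj' (hψ.aestronglyMeasurable_kernelConv hf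
      (Nat.zero_le 2) s) (ae_of_all _ (hψ.norm_kernelConv_le hB (Nat.zero_le 2) hs)) ht x
    have h2 := hasDerivAt_comp_const_add
      (hψ.hasDerivAt_kernelConv hj' hf hB (add_pos hs ht) x)
    rw [hcomm _ hj _ ht]
    refine h1.unique (h2.congr_of_eventuallyEq ?_)
    filter_upwards [lt_mem_nhds ht] with r hr
    rw [← hcomm _ hj'.le _ hr, ih hj'.le hr]

lemma kernelConv_one_kernelConv_one (hψ : IsSemigroupProfile m ψ)
    (hf : AEStronglyMeasurable f) (hB : ∀ᵐ y, ‖f y‖ ≤ B) {s t : ℝ} (hs : 0 < s) (ht : 0 < t)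
    (x : E) :
    kernelConv (dilatedKernel m ψ 1 s) (kernelConv (dilatedKernel m ψ 1 t) f) x =
      kernelConv (dilatedKernel m ψ 2 (s + t)) f x := by
  have h1 := hψ.hasDerivAt_kernelConv zero_lt_two (hψ.aestronglyMeasurable_kernelConv hf
      one_le_two t) (ae_of_all _ (hψ.norm_kernelConv_le hB one_le_two ht)) hs x
  have h2 := hψ.hasDerivAt_kernelConv one_lt_two hf hB (add_pos ht hs) x
  have h3 := hasDerivAt_comp_const_add h2
  rw [add_comm s t]
  refine h1.unique (h3.congr_of_eventuallyEq ?_)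
  filter_upwards [lt_mem_nhds hs] with r hr
  rw [hψ.kernelConv_zero_kernelConv hf hB one_le_two hr ht, add_comm]

/-- A bound on the first time derivative of the semigroup gives one on the second. -/
lemma second_deriv_bound_of_first (hψ : IsSemigroupProfile m ψ) (γ : ℝ) : ∃ Q, 0 ≤ Q ∧
    ∀ (f : E → ℂ) (B C : ℝ), AEStronglyMeasurable f → (∀ᵐ y, ‖f y‖ ≤ B) →
      (∀ t, 0 < t → ∀ᵐ x, ‖kernelConv (dilatedKernel m ψ 1 t) f x‖ ≤ C * t ^ (-1 + γ)) →
      ∀ t, 0 < t → ∀ x, ‖kernelConv (dilatedKernel m ψ 2 t) f x‖ ≤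
        Q * C * t ^ (-2 + γ) := by
  refine ⟨(∫ z, ‖ψ 1 z‖) * (1 / 2) ^ (-2 + γ), by positivity, ?_⟩
  intro f B C hf hB hC t ht x
  -- Split t in halves: one first derivative costs t^{-1} in L¹ norm of the kernel, the other obeys
  -- the hypothesis.
  have ht2 : 0 < t / 2 := half_pos ht
  rw [← add_halves t, ← hψ.kernelConv_one_kernelConv_one hf hB ht2 ht2, add_halves]
  refine (hψ.norm_kernelConv_le (hC _ ht2) one_le_two ht2 x).trans_eq ?_
  have e : (t / 2) ^ (-((1 : ℕ) : ℝ)) * (t / 2) ^ (-1 + γ) = (1 / 2) ^ (-2 + γ) * t ^ (-2 + γ) := by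
    rw [← Real.rpow_add ht2, ← Real.mul_rpow (by norm_num) ht.le]
    congr 1
    · ring
    · push_cast
      ring
  linear_combination ((∫ z, ‖ψ 1 z‖) * C) * e

lemma tendsto_kernelConv_zero (hψ : IsSemigroupProfile m ψ) (hf : Continuous f)
    (hB : ∀ y, ‖f y‖ ≤ B) (x : E) :
    Tendsto (fun ε => kernelConv (dilatedKernel m ψ 0 ε) f x) (𝓝[>] 0) (𝓝 (f x)) := by
  have hm : (0 : ℝ) < m := by exact_mod_cast hψ.order_pos
  have e : ∀ ε : ℝ, 0 < ε → kernelConv (dilatedKernel m ψ 0 ε) f x =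
      ∫ z, ψ 0 z * f (x - ε ^ (1 / (m : ℝ)) • z) := by
    intro ε hε
    have key := integral_comp_dilation (E := E) (m := m) hε
      (fun z => ψ 0 z * f (x - ε ^ (1 / (m : ℝ)) • z))
    rw [kernelConv, ← integral_sub_left_eq_self _ volume x]
    simp only [sub_sub_cancel, dilatedKernel, mul_assoc]
    rw [integral_const_mul]
    have h1 : ∀ z : E, ε ^ (1 / (m : ℝ)) • ε ^ (-(1 / (m : ℝ))) • z = z := fun z => by
      rw [smul_smul, ← Real.rpow_add hε, add_neg_cancel, Real.rpow_zero, one_smul]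
    simp only [h1] at key
    rw [key, Complex.real_smul, ← mul_assoc, ← Complex.ofReal_mul, ← Real.rpow_add hε]
    simp
  have hone : ∫ z, ψ 0 z = 1 := by
    simpa [dilatedKernel] using hψ.integral_kernel_zero one_pos
  have hlim : Tendsto (fun ε : ℝ => ∫ z, ψ 0 z * f (x - ε ^ (1 / (m : ℝ)) • z)) (𝓝[>] 0)
      (𝓝 (∫ z, ψ 0 z * f x)) := by
    have hint := hψ.integrable_profile (j := 0) (by norm_num)
    refine tendsto_integral_filter_of_dominated_convergence (fun z => ‖ψ 0 z‖ * B)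
      (Eventually.of_forall fun ε => ?_) (Eventually.of_forall fun ε => ae_of_all _ fun z => ?_)
      (hint.norm.mul_const B) (ae_of_all _ fun z => ?_)
    · exact hint.aestronglyMeasurable.mul (by fun_prop : Continuous _).aestronglyMeasurable
    · rw [norm_mul]
      exact mul_le_mul_of_nonneg_left (hB _) (norm_nonneg _)
    · have h1 : Tendsto (fun ε : ℝ => ε ^ (1 / (m : ℝ))) (𝓝[>] 0) (𝓝 0) := by
        have : ContinuousAt (fun ε : ℝ => ε ^ (1 / (m : ℝ))) 0 :=
          Real.continuousAt_rpow_const _ _ (Or.inr (by positivity))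
        have h := this.tendsto
        rw [Real.zero_rpow (by positivity)] at h
        exact h.mono_left nhdsWithin_le_nhds
      have h2 : Tendsto (fun ε : ℝ => x - ε ^ (1 / (m : ℝ)) • z) (𝓝[>] 0) (𝓝 x) := by
        simpa using (h1.smul_const z).const_sub x
      exact ((hf.tendsto x).comp h2).const_mul _
  rw [integral_mul_const, hone, one_mul] at hlim
  refine hlim.congr' ?_
  filter_upwards [self_mem_nhdsWithin] with ε hε
  exact (e ε hε).symm

/-- Uniform bounds along the semigroup for small times pass to the initial datum. -/
lemma ae_norm_le_of_kernelConv (hψ : IsSemigroupProfile m ψ) {v : E → ℂ} {R τ : ℝ}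
    (hv : AEStronglyMeasurable v) (hB : ∀ᵐ y, ‖v y‖ ≤ B) (hτ : 0 < τ)
    (hR : ∀ ε, 0 < ε → ε ≤ τ → ∀ x, ‖kernelConv (dilatedKernel m ψ 0 ε) v x‖ ≤ R) :
    ∀ᵐ x, ‖v x‖ ≤ R := by
  -- Convergence as ε → 0 is pointwise only for continuous data, so v is mollified. The mollifier
  -- commutes with the semigroup and has L¹ norm 1, so the bound R reaches the mollified function;
  -- Lebesgue differentiation then removes the mollifier almost everywhere.
  have hloc : LocallyIntegrable v := (memLp_top_of_bound hv B hB).locallyIntegrable le_top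
  let φ : ℕ → ContDiffBump (0 : E) := fun i =>
    ⟨1 / ((i : ℝ) + 1), 2 / ((i : ℝ) + 1), by positivity, by gcongr; norm_num⟩
  have hφ : Tendsto (fun i => (φ i).rOut) atTop (𝓝 0) := by
    have := (tendsto_one_div_add_atTop_nhds_zero_nat (𝕜 := ℝ)).const_mul 2
    simpa [φ, div_eq_mul_inv] using this
  have key := ContDiffBump.ae_convolution_tendsto_right_of_locallyIntegrable (φ := φ)
    (μ := volume) (K := 2) hφ (Eventually.of_forall fun i => by simp [φ, div_eq_mul_inv]) hloc
  filter_upwards [key] with x hx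
  refine le_of_tendsto hx.norm (Eventually.of_forall fun i => ?_)
  set p : E → ℂ := fun y => ((φ i).normed volume y : ℂ) with hp
  have hpint : Integrable p := (φ i).integrable_normed.ofReal
  have hpnorm : ∫ y, ‖p y‖ = 1 := by
    rw [← (φ i).integral_normed (μ := volume)]
    congr 1 with y
    rw [hp, Complex.norm_real, Real.norm_of_nonneg ((φ i).nonneg_normed y)]
  set w := kernelConv p v with hw
  have hconv : convolution ((φ i).normed volume) v (ContinuousLinearMap.lsmul ℝ ℝ) volume = w := by
    ext x
    rw [convolution_lsmul_swap]
    simp [hw, kernelConv, hp]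
  have hwc : Continuous w := by
    rw [← hconv]
    exact (φ i).hasCompactSupport_normed.continuous_convolution_left _
      (φ i).continuous_normed hloc
  have hwB : ∀ x, ‖w x‖ ≤ B := fun x => by
    simpa [hpnorm] using BiharmonicLipschitz.norm_kernelConv_le hpint hB x
  rw [hconv]
  refine le_of_tendsto (hψ.tendsto_kernelConv_zero hwc hwB x).norm ?_
  filter_upwards [Ioc_mem_nhdsGT hτ] with ε hε
  rw [hw, kernelConv_comm (hψ.integrable_kernel (by norm_num) hε.1) hpint hv hB]
  simpa [hpnorm] using BiharmonicLipschitz.norm_kernelConv_le hpint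
    (ae_of_all _ (hR ε hε.1 hε.2)) x

/-- A Zygmund condition gives bounds on time derivatives of the semigroup. -/
theorem ae_norm_kernelConv_le_of_secondDiff (hψ : IsSemigroupProfile m ψ) {j : ℕ}
    (hj : j = 1 ∨ j = 2) {α N : ℝ} (hα : Integrable (fun z => ‖ψ j z‖ * ‖z‖ ^ α))
    (hf : AEStronglyMeasurable f) (hB : ∀ᵐ y, ‖f y‖ ≤ B) (hN0 : 0 ≤ N)
    (hN : ∀ y ≠ 0, ∀ᵐ x, ‖secondDiff y f x‖ ≤ N * ‖y‖ ^ α) {t : ℝ} (ht : 0 < t) :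
    ∀ᵐ x, ‖kernelConv (dilatedKernel m ψ j t) f x‖ ≤
      ((∫ z, ‖ψ j z‖ * ‖z‖ ^ α) / 2) * N * t ^ (-(j : ℝ) + α / m) := by
  have hj2 : j ≤ 2 := by omega
  set K := dilatedKernel m ψ j t with hK
  have hKint : Integrable K := hψ.integrable_kernel hj2 ht
  -- The hypothesis holds for each y and almost every x, whereas the proof fixes x and integrates in
  -- y. Exchanging the quantifiers by Fubini requires a measurable set of pairs, hence a measurable
  -- representative of f.
  obtain ⟨g, hg, hfg⟩ := hf
  have hgB : ∀ᵐ y, ‖g y‖ ≤ B := by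
    filter_upwards [hB, hfg] with y h1 h2
    rwa [← h2]
  have hgN : ∀ y, ∀ᵐ x, ‖secondDiff y g x‖ ≤ N * ‖y‖ ^ α := by
    intro y
    rcases eq_or_ne y 0 with rfl | hy
    · refine ae_of_all _ fun x => ?_
      have : secondDiff 0 g x = 0 := by simp [secondDiff]; ring
      rw [this, norm_zero]
      positivity
    · filter_upwards [hN y hy, hfg, ae_comp_add_right hfg y, ae_comp_add_right hfg (-y)]
        with x h1 h2 h3 h4
      rw [← sub_eq_add_neg] at h4
      rwa [secondDiff, ← h2, ← h3, ← h4]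
  have hmeas : MeasurableSet {p : E × E | ‖secondDiff p.2 g p.1‖ ≤ N * ‖p.2‖ ^ α} := by
    have := hg.measurable
    unfold secondDiff
    exact measurableSet_le (by fun_prop) (by fun_prop)
  have hae := (Measure.ae_ae_comm (μ := (volume : Measure E)) (ν := (volume : Measure E))
    (p := fun x y => ‖secondDiff y g x‖ ≤ N * ‖y‖ ^ α) hmeas).2 (ae_of_all _ hgN)
  filter_upwards [hae] with x hx
  have e0 : kernelConv K f x = kernelConv K g x := by
    refine integral_congr_ae ?_
    filter_upwards [hfg] with y hy
    rw [hy]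
  have i1 : Integrable (fun z => K z * g (x - z)) := by
    have := (integrable_kernelConv_integrand hKint hg.aestronglyMeasurable hgB x).comp_sub_left x
    simpa using this
  have i2 : Integrable (fun z => K z * g (x + z)) := by
    have := i1.comp_neg
    simpa [hK, hψ.kernel_even hj2] using this
  have i3 : Integrable (fun z => K z * (2 * g x)) := hKint.mul_const _
  have e1 : kernelConv K g x = ∫ z, K z * g (x - z) := by
    rw [kernelConv, ← integral_sub_left_eq_self _ volume x]
    simp
  have e2 : kernelConv K g x = ∫ z, K z * g (x + z) := by
    rw [e1, ← integral_neg_eq_self]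
    simp [hK, hψ.kernel_even hj2]
  have e3 : ∫ z, K z * (2 * g x) = 0 := by
    rw [integral_mul_const, hψ.integral_kernel_eq_zero hj ht, zero_mul]
  -- Evenness of K lets the convolution be written with x - z and with x + z; the zero integral of K
  -- allows 2g(x) to be subtracted.
  have e4 : 2 * kernelConv K g x = ∫ z, K z * secondDiff z g x := by
    have h : ∫ z, K z * secondDiff z g x =
        ∫ z, (K z * g (x + z) + K z * g (x - z) - K z * (2 * g x)) := by
      congr 1 with z
      simp only [secondDiff]
      ring
    rw [h]
    have h1 := integral_sub (i2.add i1) i3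
    have h2 := integral_add i2 i1
    simp only [Pi.add_apply] at h1
    rw [h1, h2, ← e1, ← e2, e3]
    ring
  have e5 : ‖2 * kernelConv K g x‖ ≤ N * ∫ z, ‖K z‖ * ‖z‖ ^ α := by
    rw [e4, ← integral_const_mul]
    refine norm_integral_le_of_norm_le
      ((integrable_norm_kernel_mul_rpow ht hα).const_mul N) ?_
    filter_upwards [hx] with z hz
    rw [norm_mul]
    calc ‖K z‖ * ‖secondDiff z g x‖ ≤ ‖K z‖ * (N * ‖z‖ ^ α) := by gcongr
      _ = _ := by ring
  rw [hK, integral_norm_kernel_mul_rpow j ht, norm_mul, Complex.norm_ofNat, ← hK] at e5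
  rw [e0]
  linarith

/-- Bounds on the second time derivative of the semigroup give a Zygmund condition. -/
theorem ae_norm_secondDiff_le_of_kernelConv (hψ : IsSemigroupProfile m ψ) {α : ℝ} (hα : 0 < α)
    (hα2 : α < 2) : ∃ Q, 0 ≤ Q ∧
    ∀ (f : E → ℂ) (B C : ℝ), AEStronglyMeasurable f → (∀ᵐ y, ‖f y‖ ≤ B) → 0 ≤ C →
      (∀ t, 0 < t → ∀ᵐ x, ‖kernelConv (dilatedKernel m ψ 2 t) f x‖ ≤
        C * t ^ (-2 + α / m)) →
      ∀ y ≠ 0, ∀ᵐ x, ‖secondDiff y f x‖ ≤ Q * C * ‖y‖ ^ α := by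
  have hm : (0 : ℝ) < m := by exact_mod_cast hψ.order_pos
  obtain ⟨D, hD0, hD⟩ := hψ.integral_norm_secondDiff_kernel
  set γ := α / m with hγ
  set β := 2 / m - α / m with hβ
  have hγ0 : 0 < γ := by positivity
  have hβ0 : 0 < β := by rw [hβ, ← sub_div]; apply div_pos <;> linarith
  set A₀ := ∫ z, ‖ψ 0 z‖ with hA₀
  have hA₀0 : 0 ≤ A₀ := by positivity
  refine ⟨2 * (4 * (A₀ * (1 / 2) ^ (γ - 2))) / γ * 3 ^ γ +
    3 * (D * (1 / 2) ^ (-β - 2) / (β + 1) / β), by positivity, ?_⟩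
  intro f B C hf hB hC0 hC y hy
  set u : ℕ → ℝ → E → ℂ := fun j t => kernelConv (dilatedKernel m ψ j t) f with hu
  have hhalf : ∀ t : ℝ, t / 2 = t * (1 / 2) := fun t => by ring
  -- Smoothing over half the time turns the almost everywhere hypothesis into a bound at every x.
  have hu2 : ∀ t, 0 < t → ∀ x, ‖u 2 t x‖ ≤ A₀ * (1 / 2) ^ (γ - 2) * C * t ^ (γ - 2) := by
    intro t ht x
    have ht2 := half_pos ht
    have e := hψ.kernelConv_zero_kernelConv hf hB le_rfl ht2 ht2 x
    rw [add_halves] at e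
    simp only [hu]
    rw [← e]
    refine (hψ.norm_kernelConv_le (hC _ ht2) (Nat.zero_le 2) ht2 x).trans_eq ?_
    rw [hhalf, Nat.cast_zero, neg_zero, Real.rpow_zero, show -2 + γ = γ - 2 by ring,
      Real.mul_rpow ht.le (by norm_num)]
    ring
  have hdu2 : ∀ t, 0 < t → ∀ x, ‖secondDiff y (u 2 t) x‖ ≤
      (D * (1 / 2) ^ (-β - 2) * C * ‖y‖ ^ 2) * t ^ (-β - 2) := by
    intro t ht x
    have ht2 := half_pos ht
    have hint := hψ.integrable_kernel (j := 0) (by norm_num) ht2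
    have e : u 2 t = kernelConv (dilatedKernel m ψ 0 (t / 2)) (u 2 (t / 2)) := by
      ext x
      simp only [hu]
      rw [hψ.kernelConv_zero_kernelConv hf hB le_rfl ht2 ht2 x, add_halves]
    rw [e, secondDiff_kernelConv hint (hψ.aestronglyMeasurable_kernelConv hf le_rfl _)
      (hC _ ht2)]
    refine (BiharmonicLipschitz.norm_kernelConv_le (integrable_secondDiff hint y)
      (hC _ ht2) x).trans ?_
    calc _ ≤ (D * (t / 2) ^ (-(2 / (m : ℝ))) * ‖y‖ ^ 2) * (C * (t / 2) ^ (-2 + γ)) := by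
          gcongr
          exact hD _ ht2 y
      _ = (D * C * ‖y‖ ^ 2) * (t / 2) ^ (-β - 2) := by
          have e : (t / 2) ^ (-β - 2) = (t / 2) ^ (-(2 / (m : ℝ))) * (t / 2) ^ (-2 + γ) := by
            rw [← Real.rpow_add ht2, hβ, hγ]
            congr 1
            ring
          rw [e]
          ring
      _ = _ := by
          rw [hhalf, Real.mul_rpow ht.le (by norm_num)]
          ring
  have hdd : ∀ x, ∀ j < 2, ∀ t, 0 < t →
      HasDerivAt (fun s => secondDiff y (u j s) x) (secondDiff y (u (j + 1) t) x) t :=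
    fun x j hj t ht =>
      ((hψ.hasDerivAt_kernelConv hj hf hB ht (x + y)).add
        (hψ.hasDerivAt_kernelConv hj hf hB ht (x - y))).sub
        ((hψ.hasDerivAt_kernelConv hj hf hB ht x).const_mul 2)
  have hsd : ∀ (g : E → ℂ) (M : ℝ), (∀ x, ‖g x‖ ≤ M) → ∀ x, ‖secondDiff y g x‖ ≤ 4 * M := by
    intro g M hg x
    calc ‖secondDiff y g x‖ ≤ ‖g (x + y)‖ + ‖g (x - y)‖ + ‖2 * g x‖ :=
        (norm_sub_le _ _).trans (by gcongr; exact norm_add_le _ _)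
    _ ≤ 4 * M := by
        rw [norm_mul, Complex.norm_ofNat]
        linarith [hg (x + y), hg (x - y), hg x]
  set A := D * (1 / 2) ^ (-β - 2) * C * ‖y‖ ^ 2 with hA
  have hd1 : ∀ x t, 0 < t → ‖secondDiff y (u 1 t) x‖ ≤ A / (β + 1) * t ^ (-(β + 1)) := by
    intro x t ht
    refine norm_le_of_deriv_decay (by linarith) (hdd x 1 (by norm_num)) (fun s hs => ?_) ?_ ht
    · rw [show -(β + 1) - 1 = -β - 2 by ring]
      exact hdu2 s hs x
    · have hlim : Tendsto (fun s : ℝ => 4 * (s ^ (-((1 : ℕ) : ℝ)) * (∫ z, ‖ψ 1 z‖) * B)) atTop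
          (𝓝 0) := by
        have := (((tendsto_rpow_neg_atTop (y := ((1 : ℕ) : ℝ)) (by norm_num)).mul_const
          (∫ z, ‖ψ 1 z‖)).mul_const B).const_mul 4
        simpa using this
      refine squeeze_zero_norm' ?_ hlim
      filter_upwards [eventually_gt_atTop 0] with s hs
      exact hsd _ _ (hψ.norm_kernelConv_le hB one_le_two hs) x
  have hd0 : ∀ x t, 0 < t → ‖secondDiff y (u 0 t) x‖ ≤ A / (β + 1) / β * t ^ (-β) := by
    intro x t ht
    refine norm_le_of_deriv_decay hβ0 (hdd x 0 (by norm_num)) (fun s hs => ?_) ?_ ht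
    · rw [show -β - 1 = -(β + 1) by ring]
      exact hd1 x s hs
    -- The semigroup itself need not tend to 0 (constants are preserved), but its second difference
    -- does, the kernel carrying the difference.
    · have hlim : Tendsto (fun s : ℝ => D * s ^ (-(2 / (m : ℝ))) * ‖y‖ ^ 2 * B) atTop
          (𝓝 0) := by
        have := (((tendsto_rpow_neg_atTop (y := 2 / (m : ℝ)) (by positivity)).const_mul
          D).mul_const (‖y‖ ^ 2)).mul_const B
        simpa using this
      refine squeeze_zero_norm' ?_ hlim
      filter_upwards [eventually_gt_atTop 0] with s hs
      have hint := hψ.integrable_kernel (j := 0) (by norm_num) hs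
      simp only [hu]
      rw [secondDiff_kernelConv hint hf hB]
      refine (BiharmonicLipschitz.norm_kernelConv_le (integrable_secondDiff hint y) hB x).trans ?_
      have hB0 : 0 ≤ B := by
        obtain ⟨z, hz⟩ := hB.exists
        exact (norm_nonneg _).trans hz
      gcongr
      exact hD s hs y
  have hy0 : 0 < ‖y‖ := norm_pos_iff.2 hy
  -- The parabolic scale, at which both τ^γ and |y|² τ^{-β} equal |y|^α.
  set τ := ‖y‖ ^ (m : ℝ) with hτ
  have hτ0 : 0 < τ := Real.rpow_pos_of_pos hy0 _
  refine hψ.ae_norm_le_of_kernelConv (aestronglyMeasurable_secondDiff hf y)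
    (ae_norm_secondDiff_le hB y) hτ0 fun ε hε hετ x => ?_
  rw [← secondDiff_kernelConv' (hψ.integrable_kernel (by norm_num) hε) hf hB]
  have s1 := norm_forward_diff_two_le hγ0 hε hετ (hdd x 0 (by norm_num))
    (hdd x 1 (by norm_num)) (M := 4 * (A₀ * (1 / 2) ^ (γ - 2) * C)) (fun s hs => by
      rw [mul_assoc]
      exact hsd _ _ (hu2 s hs) x)
  have hA0 : 0 ≤ A := by positivity
  have s2 : ∀ r, τ ≤ r → ‖secondDiff y (u 0 r) x‖ ≤ A / (β + 1) / β * τ ^ (-β) := by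
    intro r hr
    refine (hd0 x r (hτ0.trans_le hr)).trans ?_
    gcongr ?_ * ?_
    exact Real.rpow_le_rpow_of_nonpos hτ0 hr (by linarith)
  have s3 : ‖secondDiff y (u 0 ε) x‖ ≤ 2 * (4 * (A₀ * (1 / 2) ^ (γ - 2) * C)) / γ *
      (3 * τ) ^ γ + 3 * (A / (β + 1) / β * τ ^ (-β)) := by
    have e : secondDiff y (u 0 ε) x = (secondDiff y (u 0 ε) x -
        2 * secondDiff y (u 0 (ε + τ)) x + secondDiff y (u 0 (ε + 2 * τ)) x) +
        2 * secondDiff y (u 0 (ε + τ)) x - secondDiff y (u 0 (ε + 2 * τ)) x := by ring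
    rw [e]
    refine (norm_sub_le _ _).trans ((add_le_add_left (norm_add_le _ _) _).trans ?_)
    rw [norm_mul, Complex.norm_ofNat]
    linarith [s2 (ε + τ) (by linarith), s2 (ε + 2 * τ) (by linarith)]
  refine s3.trans_eq ?_
  have p1 : τ ^ γ = ‖y‖ ^ α := by
    rw [hτ, ← Real.rpow_mul hy0.le, hγ]
    congr 1
    field_simp
  have p2 : ‖y‖ ^ 2 * τ ^ (-β) = ‖y‖ ^ α := by
    rw [hτ, ← Real.rpow_mul hy0.le, ← Real.rpow_natCast, ← Real.rpow_add hy0, hβ]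
    congr 1
    push_cast
    field_simp
    ring
  rw [Real.mul_rpow (by norm_num) hτ0.le, p1, hA]
  linear_combination (3 * (D * (1 / 2) ^ (-β - 2) * C / (β + 1) / β)) * p2

end IsSemigroupProfile

/-! ### Moments and L¹ second differences of decaying functions -/

section DecayingProfile

variable {E : Type*} [NormedAddCommGroup E] [InnerProductSpace ℝ E] [FiniteDimensional ℝ E]
  [MeasurableSpace E] [BorelSpace E]

lemma integrable_norm_mul_rpow {φ : E → ℂ} (hφ : Continuous φ) {C r α : ℝ}
    (hC : ∀ z, ‖φ z‖ ≤ C * (1 + ‖z‖) ^ (-r)) (hα : 0 ≤ α)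
    (hr : (Module.finrank ℝ E : ℝ) + α < r) : Integrable (fun z => ‖φ z‖ * ‖z‖ ^ α) := by
  have h : Integrable (fun z : E => C * (1 + ‖z‖) ^ (-(r - α))) :=
    (integrable_one_add_norm (by linarith)).const_mul C
  have hcont : Continuous (fun z : E => ‖φ z‖ * ‖z‖ ^ α) :=
    hφ.norm.mul (continuous_norm.rpow_const fun _ => Or.inr hα)
  refine h.mono' hcont.aestronglyMeasurable (ae_of_all _ fun z => ?_)
  have h1 : 0 < 1 + ‖z‖ := by positivity
  rw [Real.norm_of_nonneg (by positivity), show -(r - α) = -r + α by ring, Real.rpow_add h1,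
    ← mul_assoc]
  gcongr
  · exact (norm_nonneg _).trans (hC z)
  · exact hC z
  · linarith

/-- An integrable function with integrable second derivatives has second differences of `L¹`-norm
`O(‖y‖²)`. -/
lemma exists_integral_norm_secondDiff_le {φ : E → ℂ} {C : ℝ} (hφ : Integrable φ)
    (h2 : ∀ x y : E, ∃ g' g'' : ℝ → ℂ, ∀ s : ℝ, HasDerivAt (fun r : ℝ => φ (x + r • y)) (g' s) s ∧
      HasDerivAt g' (g'' s) s ∧
      ‖g'' s‖ ≤ C * ‖y‖ ^ 2 * (1 + ‖x + s • y‖) ^ (-((Module.finrank ℝ E : ℝ) + 1))) :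
    ∃ C', ∀ y, ∫ x, ‖secondDiff y φ x‖ ≤ C' * ‖y‖ ^ 2 := by
  set p : ℝ := (Module.finrank ℝ E : ℝ) + 1 with hp
  have hp0 : 0 < p := by positivity
  have hJ : Integrable (fun x : E => (1 + ‖x‖) ^ (-p)) :=
    integrable_one_add_norm (by rw [hp]; linarith)
  set J := ∫ x : E, (1 + ‖x‖) ^ (-p) with hJdef
  have hJ0 : 0 ≤ J := integral_nonneg fun x => by positivity
  refine ⟨2 * (|C| * 2 ^ p) * J + 4 * ∫ x, ‖φ x‖, fun y => ?_⟩
  have hint0 : 0 ≤ ∫ x, ‖φ x‖ := by positivity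
  -- For |y| ≤ 1 the weights at x and x + sy with |s| ≤ 1 are comparable, which costs 2^p. For |y| ≥
  -- 1 the trivial bound 4‖φ‖₁ is at most 4‖φ‖₁ |y|².
  rcases le_total ‖y‖ 1 with hy | hy
  · have hpt : ∀ x, ‖secondDiff y φ x‖ ≤
        2 * (|C| * 2 ^ p) * ‖y‖ ^ 2 * (1 + ‖x‖) ^ (-p) := by
      intro x
      obtain ⟨g', g'', hg⟩ := h2 x y
      have key := norm_central_diff_two_le (g := fun r : ℝ => φ (x + r • y))
        (M := |C| * 2 ^ p * ‖y‖ ^ 2 * (1 + ‖x‖) ^ (-p)) (fun s _ => (hg s).1)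
        (fun s _ => (hg s).2.1) (fun s hs => by
          refine (hg s).2.2.trans ?_
          have hs1 : |s| ≤ 1 := abs_le.2 hs
          have hsy : ‖s • y‖ ≤ 1 := by
            rw [norm_smul, Real.norm_eq_abs]
            exact mul_le_one₀ hs1 (norm_nonneg _) hy
          have hx : ‖x‖ ≤ ‖x + s • y‖ + ‖s • y‖ := by
            simpa using norm_sub_le (x + s • y) (s • y)
          have hge : (1 + ‖x‖) / 2 ≤ 1 + ‖x + s • y‖ := by
            linarith [norm_nonneg (x + s • y)]
          calc C * ‖y‖ ^ 2 * (1 + ‖x + s • y‖) ^ (-p)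
              ≤ |C| * ‖y‖ ^ 2 * ((1 + ‖x‖) / 2) ^ (-p) := by
                gcongr ?_ * _ * ?_
                · exact le_abs_self C
                · exact Real.rpow_le_rpow_of_nonpos (by positivity) hge (by linarith)
            _ = _ := by
                rw [Real.div_rpow (by positivity) (by norm_num), Real.rpow_neg two_pos.le]
                field_simp)
      simp only [one_smul, neg_smul, zero_smul, add_zero, ← sub_eq_add_neg] at key
      exact key.trans_eq (by ring)
    have h3 : ∫ x, ‖secondDiff y φ x‖ ≤
        ∫ x, 2 * (|C| * 2 ^ p) * ‖y‖ ^ 2 * (1 + ‖x‖) ^ (-p) :=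
      integral_mono (integrable_secondDiff hφ y).norm (hJ.const_mul _) hpt
    rw [integral_const_mul] at h3
    nlinarith [mul_nonneg hint0 (sq_nonneg ‖y‖)]
  · have i1 := (hφ.comp_add_right y).norm
    have i2 := (hφ.comp_sub_right y).norm
    have h3 : ∫ x, ‖secondDiff y φ x‖ ≤ ∫ x, (‖φ (x + y)‖ + ‖φ (x - y)‖ + 2 * ‖φ x‖) := by
      refine integral_mono (integrable_secondDiff hφ y).norm
        ((i1.add i2).add (hφ.norm.const_mul 2)) fun x => ?_
      refine (norm_sub_le _ _).trans ?_
      rw [norm_mul, Complex.norm_ofNat]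
      gcongr
      exact norm_add_le _ _
    have h4 := integral_add (i1.add i2) (hφ.norm.const_mul 2)
    have h5 := integral_add i1 i2
    simp only [Pi.add_apply] at h4
    rw [h4, h5, integral_const_mul, integral_add_right_eq_self (fun x => ‖φ x‖),
      integral_sub_right_eq_self (fun x => ‖φ x‖)] at h3
    have hy2 : 1 ≤ ‖y‖ ^ 2 := one_le_pow₀ hy
    have : 0 ≤ 2 * (|C| * 2 ^ p) * J := by positivity
    nlinarith

end DecayingProfile

/-! ### The biharmonic heat kernel -/

section Biharmonic

open scoped SchwartzMap ContDiff

variable {E : Type*} [NormedAddCommGroup E] [InnerProductSpace ℝ E]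

/-- The symbol `exp(-(2π|v|)⁴)` as a Schwartz function. -/
def symbolSchwartz (E : Type*) [NormedAddCommGroup E] [InnerProductSpace ℝ E] : 𝓢(E, ℂ) where
  toFun := symbol 4 1
  smooth' := by
    have h : ContDiff ℝ ∞ (fun v : E => ((2 * Real.pi) ^ 4 * (‖v‖ ^ 2) ^ 2)) :=
      contDiff_const.mul ((contDiff_norm_sq ℝ).pow 2)
    have h2 : ContDiff ℝ ∞ (fun v : E => (Real.exp (-((2 * Real.pi) ^ 4 * (‖v‖ ^ 2) ^ 2)) : ℂ)) :=
      Complex.ofRealCLM.contDiff.comp (Real.contDiff_exp.comp h.neg)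
    convert h2 using 2 with v
    rw [symbol]
    congr 2
    ring
  decay' := by
    intro k n
    set p : E → ℝ := fun v => (2 * Real.pi) ^ 4 * (‖v‖ ^ 2) ^ 2 with hp
    have hpg : Function.HasTemperateGrowth p :=
      (Function.HasTemperateGrowth.const _).mul ((Function.hasTemperateGrowth_norm_sq E).pow 2)
    obtain ⟨l, C, hC0, hC⟩ := hpg.norm_iteratedFDeriv_le_uniform n
    have hexp : ContDiff ℝ ∞ (fun s : ℝ => Real.exp (-1 * s)) := by fun_prop
    have heq : symbol (E := E) 4 1 =
        Complex.ofRealLI ∘ ((fun s : ℝ => Real.exp (-1 * s)) ∘ p) := by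
      ext v
      simp only [symbol, Function.comp_apply, Complex.ofRealLI_apply, hp]
      congr 2
      ring
    have hc : (0 : ℝ) < (2 * Real.pi) ^ 4 := by positivity
    set A := (2 : ℝ) ^ (k + l * n) *
      (1 + (k + l * n).factorial / ((2 * Real.pi) ^ 4) ^ (k + l * n)) with hA
    refine ⟨n.factorial * (C + 1) ^ n * A, fun v => ?_⟩
    rw [heq, LinearIsometry.norm_iteratedFDeriv_comp_left _
      ((hexp.comp hpg.1).contDiffAt.of_le (mod_cast le_top)) le_rfl]
    have h1 : (1 : ℝ) ≤ (1 + ‖v‖) ^ l := one_le_pow₀ (by simp)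
    have hD1 : 1 ≤ (C + 1) * (1 + ‖v‖) ^ l := by nlinarith
    -- The n-th derivative of exp(-p) is at most exp(-p) times a power of 1 + |v|, because p has
    -- temperate growth; `hdec` absorbs that power together with |v|^k.
    have key := norm_iteratedFDeriv_comp_le (g := fun s : ℝ => Real.exp (-1 * s)) (f := p)
      (n := n) hexp hpg.1 (mod_cast le_top) v (C := Real.exp (-p v))
      (D := (C + 1) * (1 + ‖v‖) ^ l)
      (fun i _ => by
        rw [norm_iteratedFDeriv_eq_norm_iteratedDeriv, iteratedDeriv_exp_const_mul]
        simp)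
      (fun i hi1 hi => by
        refine (hC i hi v).trans (le_trans ?_ (le_self_pow₀ hD1 (by omega)))
        gcongr
        linarith)
    have hdec := one_add_pow_le_exp hc (m := 4) (by norm_num) (k + l * n) (norm_nonneg v)
    rw [← hA, show (2 * Real.pi) ^ 4 * ‖v‖ ^ 4 = p v by rw [hp]; ring] at hdec
    calc ‖v‖ ^ k * _ ≤ (1 + ‖v‖) ^ k * (n.factorial * Real.exp (-p v) *
          ((C + 1) * (1 + ‖v‖) ^ l) ^ n) := by
          gcongr
          · linarith
      _ = n.factorial * (C + 1) ^ n * Real.exp (-p v) * (1 + ‖v‖) ^ (k + l * n) := by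
          rw [mul_pow, ← pow_mul, pow_add]
          ring
      _ ≤ n.factorial * (C + 1) ^ n * Real.exp (-p v) * (A * Real.exp (p v)) := by gcongr
      _ = n.factorial * (C + 1) ^ n * A * (Real.exp (-p v) * Real.exp (p v)) := by ring
      _ = _ := by rw [← Real.exp_add]; simp

lemma exists_schwartz_decay {F : Type*} [NormedAddCommGroup F] [NormedSpace ℝ F]
    (f : 𝓢(E, F)) (N : ℕ) : ∃ C, 0 ≤ C ∧ ∀ z, ‖f z‖ ≤ C * (1 + ‖z‖) ^ (-(N : ℝ)) := by
  refine ⟨2 ^ N * ((Finset.Iic (N, 0)).sup fun m => SchwartzMap.seminorm ℝ m.1 m.2) f,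
    by positivity, fun z => ?_⟩
  have h := SchwartzMap.one_add_le_sup_seminorm_apply (𝕜 := ℝ) (m := (N, 0)) (k := N) (n := 0)
    le_rfl le_rfl f z
  rw [norm_iteratedFDeriv_zero] at h
  rw [Real.rpow_neg (by positivity), Real.rpow_natCast, ← div_eq_mul_inv,
    le_div_iff₀ (by positivity), mul_comm]
  exact h

/-- The Euler operator `φ ↦ z · ∇φ` on Schwartz functions. -/
def eulerSchwartz (φ : 𝓢(E, ℂ)) : 𝓢(E, ℂ) :=
  SchwartzMap.bilinLeftCLM (𝕜 := ℝ) (ContinuousLinearMap.id ℝ (E →L[ℝ] ℂ))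
    Function.HasTemperateGrowth.id' (SchwartzMap.fderivCLM ℝ E ℂ φ)

lemma eulerSchwartz_apply (φ : 𝓢(E, ℂ)) (z : E) : eulerSchwartz φ z = fderiv ℝ φ z z := rfl

variable [FiniteDimensional ℝ E] [MeasurableSpace E] [BorelSpace E]

/-- The profiles at time one of the biharmonic heat kernel and of its time derivatives. -/
def biharmonicProfile : ℕ → 𝓢(E, ℂ)
  | 0 => 𝓕⁻ (symbolSchwartz E)
  | j + 1 => (-((Module.finrank ℝ E : ℂ) / 4 + j)) • biharmonicProfile j -
      (1 / 4 : ℂ) • eulerSchwartz (biharmonicProfile j)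

lemma biharmonicProfile_zero :
    ⇑(biharmonicProfile (E := E) 0) = 𝓕⁻ (symbol (E := E) 4 1) := by
  rw [biharmonicProfile, SchwartzMap.fourierInv_coe]
  rfl

lemma biharmonicProfile_even (j : ℕ) (z : E) :
    biharmonicProfile j (-z) = biharmonicProfile j z := by
  induction j generalizing z with
  | zero =>
    rw [biharmonicProfile_zero]
    have h := Real.fourierInv_comp_linearIsometry (LinearIsometryEquiv.neg ℝ (E := E))
      (symbol 4 1) z
    have e : symbol (E := E) 4 1 ∘ (LinearIsometryEquiv.neg ℝ (E := E)) = symbol 4 1 := by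
      ext v
      simp [symbol]
    rw [e] at h
    exact h.symm
  | succ j ih =>
    set φ := biharmonicProfile (E := E) j
    have h1 : HasFDerivAt (fun x => φ (-x)) ((fderiv ℝ φ (-z)).comp (-ContinuousLinearMap.id ℝ E))
        z := (φ.hasFDerivAt (-z)).comp z (hasFDerivAt_id z).neg
    rw [funext ih] at h1
    have h : fderiv ℝ φ z z = fderiv ℝ φ (-z) (-z) := by
      rw [h1.fderiv]
      simp
    simp only [biharmonicProfile, sub_apply, smul_apply, eulerSchwartz_apply]
    rw [ih, h]

theorem isSemigroupProfile_biharmonic :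
    IsSemigroupProfile (E := E) 4 (fun j => biharmonicProfile j) where
  order_pos := by norm_num
  continuous j _ := (biharmonicProfile j).continuous
  decay := by
    choose C hC0 hC using fun j : ℕ =>
      exists_schwartz_decay (biharmonicProfile (E := E) j) (Module.finrank ℝ E + 1)
    refine ⟨C 0 + C 1 + C 2, fun j hj z => (hC j z).trans ?_⟩
    push_cast
    gcongr
    have := hC0 0; have := hC0 1; have := hC0 2
    interval_cases j <;> linarith
  even j _ := biharmonicProfile_even j
  euler j _ z := by
    refine ⟨fderiv ℝ (biharmonicProfile j) z z, ?_, ?_⟩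
    · have h1 : HasDerivAt (fun r : ℝ => r • z) z 1 := by
        simpa using (hasDerivAt_id (1 : ℝ)).smul_const z
      have h2 := (biharmonicProfile (E := E) j).hasFDerivAt ((1 : ℝ) • z)
      rw [one_smul] at h2
      have h3 : HasFDerivAt (biharmonicProfile (E := E) j)
        (fderiv ℝ (biharmonicProfile (E := E) j) z) ((1 : ℝ) • z) := by rwa [one_smul]
      exact h3.comp_hasDerivAt 1 h1
    · simp [biharmonicProfile, eulerSchwartz_apply]
  fourierInv_symbol := biharmonicProfile_zero
  integral_secondDiff_le := by
    set φ := biharmonicProfile (E := E) 0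
    set φ₂ := SchwartzMap.fderivCLM ℝ E (E →L[ℝ] ℂ) (SchwartzMap.fderivCLM ℝ E ℂ φ) with hφ₂
    obtain ⟨C, hC0, hC⟩ := exists_schwartz_decay φ₂ (Module.finrank ℝ E + 1)
    refine exists_integral_norm_secondDiff_le (C := C) φ.integrable fun x y =>
      ⟨fun s => fderiv ℝ φ (x + s • y) y, fun s => φ₂ (x + s • y) y y, fun s => ?_⟩
    have hl : HasDerivAt (fun r : ℝ => x + r • y) y s := by
      simpa using ((hasDerivAt_id s).smul_const y).const_add x
    refine ⟨(φ.hasFDerivAt (x + s • y)).comp_hasDerivAt s hl, ?_, ?_⟩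
    · have h1 := ((SchwartzMap.fderivCLM ℝ E ℂ φ).hasFDerivAt (x + s • y)).comp_hasDerivAt s hl
      exact h1.clm_apply (hasDerivAt_const s y) |>.congr_deriv (by simp; rfl)
    · have h := hC (x + s • y)
      push_cast at h
      calc ‖φ₂ (x + s • y) y y‖ ≤ ‖φ₂ (x + s • y)‖ * ‖y‖ * ‖y‖ :=
            (φ₂ (x + s • y)).le_opNorm₂ y y
        _ ≤ _ := by
          rw [mul_assoc, ← sq, mul_comm, mul_assoc, mul_left_comm]
          gcongr

lemma integrable_biharmonicProfile_mul_rpow (j : ℕ) {α : ℝ} (hα : 0 ≤ α) :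
    Integrable (fun z : E => ‖biharmonicProfile j z‖ * ‖z‖ ^ α) := by
  obtain ⟨C, -, hC⟩ := exists_schwartz_decay (biharmonicProfile (E := E) j)
    (Module.finrank ℝ E + ⌈α⌉₊ + 1)
  refine integrable_norm_mul_rpow (biharmonicProfile j).continuous hC hα ?_
  push_cast
  linarith [Nat.le_ceil α]

end Biharmonic

/-! ### Subordination of the Poisson kernel to Gaussians -/

section Subordination

/-- `∫_0^w exp(-x²) dx`. -/
def gaussPrimitive (w : ℝ) : ℝ := ∫ x in (0 : ℝ)..w, Real.exp (-x ^ 2)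

lemma hasDerivAt_gaussPrimitive (w : ℝ) :
    HasDerivAt gaussPrimitive (Real.exp (-w ^ 2)) w := by
  have h : Continuous (fun x : ℝ => Real.exp (-x ^ 2)) := by fun_prop
  exact (h.integral_hasStrictDerivAt 0 w).hasDerivAt

lemma gaussPrimitive_neg (w : ℝ) : gaussPrimitive (-w) = -gaussPrimitive w := by
  have h := intervalIntegral.integral_comp_neg (a := 0) (b := w)
    (fun x : ℝ => Real.exp (-x ^ 2))
  simp only [neg_sq, neg_zero] at h
  rw [gaussPrimitive, gaussPrimitive, h, intervalIntegral.integral_symm]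

lemma tendsto_gaussPrimitive_atTop :
    Tendsto gaussPrimitive atTop (𝓝 (Real.sqrt Real.pi / 2)) := by
  have h1 : Integrable (fun x : ℝ => Real.exp (-x ^ 2)) := by
    simpa using integrable_exp_neg_mul_sq one_pos
  have h2 := intervalIntegral_tendsto_integral_Ioi 0 h1.integrableOn tendsto_id
  have h3 := integral_gaussian_Ioi 1
  simp only [neg_mul, one_mul, div_one] at h3
  rwa [h3] at h2

lemma tendsto_gaussPrimitive_atBot :
    Tendsto gaussPrimitive atBot (𝓝 (-(Real.sqrt Real.pi / 2))) := by
  have h := (tendsto_gaussPrimitive_atTop.comp tendsto_neg_atBot_atTop).neg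
  refine h.congr fun w => ?_
  simp [gaussPrimitive_neg]

/-- The subordination identity `∫_0^∞ u^{-1/2} exp(-u - r²/u) du = √π exp(-2r)`. -/
lemma integral_subordination {r : ℝ} (hr : 0 ≤ r) :
    ∫ u in Ioi (0 : ℝ), u ^ (-(1 / 2) : ℝ) * Real.exp (-u - r ^ 2 / u) =
      Real.sqrt Real.pi * Real.exp (-(2 * r)) := by
  -- At r = 0 the quotient r/√u does not blow up at the origin, and the integral is Γ(1/2).
  rcases hr.eq_or_lt with rfl | hr
  · have h := Real.integral_rpow_mul_exp_neg_mul_Ioi (a := 1 / 2) (r := 1) (by norm_num) one_pos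
    rw [Real.Gamma_one_half_eq] at h
    norm_num at h ⊢
    exact h
  -- An antiderivative of e^{2r} times the integrand: the terms r u^{-3/2} from the two inner
  -- derivatives cancel. The boundary values differ by 2L = √π.
  set F : ℝ → ℝ := fun u => gaussPrimitive (Real.sqrt u - r / Real.sqrt u) +
    Real.exp (4 * r) * gaussPrimitive (Real.sqrt u + r / Real.sqrt u) with hF
  set L : ℝ := Real.sqrt Real.pi / 2 with hL
  have hinv : Tendsto (fun u : ℝ => r / Real.sqrt u) atTop (𝓝 0) :=
    tendsto_const_nhds.div_atTop Real.tendsto_sqrt_atTop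
  have htop : Tendsto F atTop (𝓝 (L + Real.exp (4 * r) * L)) := by
    refine (tendsto_gaussPrimitive_atTop.comp ?_).add
      ((tendsto_gaussPrimitive_atTop.comp ?_).const_mul _)
    · exact Real.tendsto_sqrt_atTop.atTop_add hinv.neg |>.congr fun u => (sub_eq_add_neg _ _).symm
    · exact Real.tendsto_sqrt_atTop.atTop_add hinv
  have hs0 : Tendsto Real.sqrt (𝓝[>] 0) (𝓝 0) := by
    have := (Real.continuous_sqrt.tendsto 0).mono_left (nhdsWithin_le_nhds (s := Ioi 0))
    simpa using this
  have hs0' : Tendsto Real.sqrt (𝓝[>] 0) (𝓝[>] 0) := by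
    refine tendsto_nhdsWithin_iff.2 ⟨hs0, ?_⟩
    filter_upwards [self_mem_nhdsWithin] with u hu using Real.sqrt_pos.2 hu
  have hinv0 : Tendsto (fun u : ℝ => r / Real.sqrt u) (𝓝[>] 0) atTop := by
    simp_rw [div_eq_mul_inv]
    exact (tendsto_inv_nhdsGT_zero.comp hs0').const_mul_atTop hr
  have hzero : Tendsto F (𝓝[>] 0) (𝓝 (-L + Real.exp (4 * r) * L)) := by
    refine (tendsto_gaussPrimitive_atBot.comp ?_).add
      ((tendsto_gaussPrimitive_atTop.comp ?_).const_mul _)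
    · exact hs0.add_atBot (tendsto_neg_atTop_atBot.comp hinv0) |>.congr
        fun u => (sub_eq_add_neg _ _).symm
    · exact hs0.add_atTop hinv0
  have hderiv : ∀ u ∈ Ioi (0 : ℝ), HasDerivAt F
      (Real.exp (2 * r) * (u ^ (-(1 / 2) : ℝ) * Real.exp (-u - r ^ 2 / u))) u := by
    intro u hu
    have hu : 0 < u := hu
    have hsu : 0 < Real.sqrt u := Real.sqrt_pos.2 hu
    have hsq : HasDerivAt Real.sqrt (1 / (2 * Real.sqrt u)) u := Real.hasDerivAt_sqrt hu.ne'
    have hdiv : HasDerivAt (fun u => r / Real.sqrt u)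
        (-(r * (1 / (2 * Real.sqrt u)) / Real.sqrt u ^ 2)) u := by
      refine ((hasDerivAt_const u r).div hsq hsu.ne').congr_deriv ?_
      simp [neg_div]
    have h1 := (hasDerivAt_gaussPrimitive _).comp u (hsq.sub hdiv)
    have h2 := (hasDerivAt_gaussPrimitive _).comp u (hsq.add hdiv)
    refine (h1.add (h2.const_mul (Real.exp (4 * r)))).congr_deriv ?_
    simp only [Pi.add_apply, Pi.sub_apply]
    have hs2 : Real.sqrt u ^ 2 = u := Real.sq_sqrt hu.le
    have hpow : u ^ (-(1 / 2) : ℝ) = (Real.sqrt u)⁻¹ := by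
      rw [Real.rpow_neg hu.le, ← Real.sqrt_eq_rpow]
    have e1 : -(Real.sqrt u - r / Real.sqrt u) ^ 2 = 2 * r + (-u - r ^ 2 / u) := by
      rw [sub_sq, div_pow, hs2]
      field_simp
      ring
    have e2 : -(Real.sqrt u + r / Real.sqrt u) ^ 2 = -(4 * r) + (2 * r + (-u - r ^ 2 / u)) := by
      rw [add_sq, div_pow, hs2]
      field_simp
      ring
    rw [e1, e2, Real.exp_add (-(4 * r)), Real.exp_add (2 * r), hpow, hs2, Real.exp_neg (4 * r)]
    have := (Real.exp_pos (4 * r)).ne'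
    field_simp
    ring
  -- With division by zero equal to 0, `F 0` is 0 instead of the right limit, hence the corrected
  -- value.
  have hcont : ContinuousWithinAt (Function.update F 0 (-L + Real.exp (4 * r) * L)) (Ici 0) 0 := by
    rw [continuousWithinAt_update_same]
    simpa using hzero
  have key := integral_Ioi_of_hasDerivAt_of_nonneg (l := L + Real.exp (4 * r) * L) hcont
    (fun u hu => (hderiv u hu).congr_of_eventuallyEq (by
      filter_upwards [lt_mem_nhds hu] with w hw
      exact Function.update_of_ne (ne_of_gt hw) _ _))
    (fun u hu => by have : 0 < u := hu; positivity)
    (htop.congr' (by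
      filter_upwards [eventually_gt_atTop 0] with w hw
      exact (Function.update_of_ne (ne_of_gt hw) _ _).symm))
  rw [integral_const_mul, Function.update_self] at key
  rw [Real.exp_neg, ← div_eq_mul_inv, eq_div_iff (Real.exp_pos (2 * r)).ne', mul_comm, key, hL]
  ring

variable {E : Type*} [NormedAddCommGroup E] [InnerProductSpace ℝ E] [FiniteDimensional ℝ E]
  [MeasurableSpace E] [BorelSpace E]

lemma fourierInv_gaussian {b : ℝ} (hb : 0 < b) (x : E) :
    ∫ v : E, Complex.exp (((2 * Real.pi * inner ℝ v x : ℝ) : ℂ) * Complex.I) *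
      (Real.exp (-b * ‖v‖ ^ 2) : ℂ) =
      (((Real.pi / b) ^ ((Module.finrank ℝ E : ℝ) / 2) *
        Real.exp (-(Real.pi ^ 2 * ‖x‖ ^ 2 / b)) : ℝ) : ℂ) := by
  have h := fourier_gaussian_innerProductSpace (V := E) (b := (b : ℂ)) (by simpa using hb) (-x)
  rw [← Real.fourierInv_eq_fourier_neg, Real.fourierInv_eq'] at h
  simp only [smul_eq_mul] at h
  push_cast at h ⊢
  rw [h, Complex.ofReal_cpow (by positivity)]
  simp [neg_div]

lemma integral_exp_neg_mul_norm_sq {b : ℝ} (hb : 0 < b) :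
    ∫ v : E, Real.exp (-b * ‖v‖ ^ 2) = (Real.pi / b) ^ ((Module.finrank ℝ E : ℝ) / 2) :=
  GaussianFourier.integral_rexp_neg_mul_sq_norm hb

lemma integrable_exp_neg_mul_norm_sq {b : ℝ} (hb : 0 < b) :
    Integrable (fun v : E => Real.exp (-b * ‖v‖ ^ 2)) := by
  refine Integrable.of_integral_ne_zero ?_
  rw [integral_exp_neg_mul_norm_sq hb]
  positivity

lemma integrableOn_rpow_mul_exp {a q : ℝ} (ha : 0 < a) (hq : 0 < q) :
    IntegrableOn (fun u : ℝ => u ^ (a - 1) * Real.exp (-(q * u))) (Ioi 0) := by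
  refine Integrable.of_integral_ne_zero ?_
  rw [Real.integral_rpow_mul_exp_neg_mul_Ioi ha hq]
  have := Real.Gamma_pos_of_pos ha
  positivity

/-- The inverse Fourier transform of `exp(-2π|v|)` is the Poisson kernel at time one. -/
theorem fourierInv_symbol_one (x : E) :
    𝓕⁻ (symbol (E := E) 1 1) x =
      ((Real.Gamma (((Module.finrank ℝ E : ℝ) + 1) / 2) /
        Real.pi ^ (((Module.finrank ℝ E : ℝ) + 1) / 2) *
        (1 + ‖x‖ ^ 2) ^ (-(((Module.finrank ℝ E : ℝ) + 1) / 2)) : ℝ) : ℂ) := by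
  set d : ℝ := (Module.finrank ℝ E : ℝ) with hd
  have hd0 : 0 ≤ d := Nat.cast_nonneg _
  have hpi := Real.pi_pos
  set e : E → ℂ := fun v => Complex.exp (((2 * Real.pi * inner ℝ v x : ℝ) : ℂ) * Complex.I) with he
  have hecont : Continuous e := by fun_prop
  have henorm : ∀ v, ‖e v‖ = 1 := fun v => Complex.norm_exp_ofReal_mul_I _
  -- The symbol is a superposition over u of the Gaussians exp(-π²|v|²/u). Integrating first in v
  -- inverts each Gaussian, and the remaining u-integral is a Gamma integral.
  set Φ : E × ℝ → ℂ := fun p => e p.1 * (Real.exp (-(Real.pi ^ 2 / p.2) * ‖p.1‖ ^ 2) : ℂ) *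
    ((p.2 ^ (-(1 / 2) : ℝ) * Real.exp (-p.2) : ℝ) : ℂ) with hΦ
  set μ : Measure ℝ := volume.restrict (Ioi (0 : ℝ)) with hμ
  have hinner : ∀ u ∈ Ioi (0 : ℝ), ∫ v, ‖Φ (v, u)‖ =
      Real.pi ^ (-(d / 2)) * (u ^ ((d + 1) / 2 - 1) * Real.exp (-(1 * u))) := by
    intro u hu
    have hu : 0 < u := hu
    have h1 : ∀ v, ‖Φ (v, u)‖ = Real.exp (-(Real.pi ^ 2 / u) * ‖v‖ ^ 2) *
        (u ^ (-(1 / 2) : ℝ) * Real.exp (-u)) := fun v => by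
      simp only [hΦ]
      rw [norm_mul, norm_mul, henorm, Complex.norm_real, Complex.norm_real,
        Real.norm_of_nonneg (by positivity), Real.norm_of_nonneg (by positivity), one_mul]
    simp_rw [h1]
    rw [integral_mul_const, integral_exp_neg_mul_norm_sq (by positivity),
      show Real.pi / (Real.pi ^ 2 / u) = u / Real.pi by field_simp,
      Real.div_rpow hu.le hpi.le, ← hd, Real.rpow_neg hpi.le,
      show (d + 1) / 2 - 1 = d / 2 + -(1 / 2) by ring, Real.rpow_add hu, one_mul]
    ring
  have hΦint : Integrable Φ (volume.prod μ) := by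
    have hmeas : AEStronglyMeasurable Φ (volume.prod μ) := by
      refine Measurable.aestronglyMeasurable ?_
      have := hecont.measurable
      simp only [hΦ]
      fun_prop
    rw [integrable_prod_iff' hmeas]
    constructor
    · refine (ae_restrict_iff' measurableSet_Ioi).2 (ae_of_all _ fun u hu => ?_)
      have hu : 0 < u := hu
      have h1 := (integrable_exp_neg_mul_norm_sq (E := E) (b := Real.pi ^ 2 / u)
        (by positivity)).ofReal (𝕜 := ℂ)
      exact (h1.bdd_mul (c := 1) hecont.aestronglyMeasurable
        (ae_of_all _ fun v => (henorm v).le)).mul_const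
          ((u ^ (-(1 / 2) : ℝ) * Real.exp (-u) : ℝ) : ℂ)
    · refine Integrable.congr (((integrableOn_rpow_mul_exp (a := (d + 1) / 2) (q := 1)
        (by positivity) one_pos)).const_mul (Real.pi ^ (-(d / 2)))) ?_
      refine (ae_restrict_iff' measurableSet_Ioi).2 (ae_of_all _ fun u hu => ?_)
      exact (hinner u hu).symm
  have hsymb : ∀ v, e v * symbol 1 1 v = ((Real.sqrt Real.pi)⁻¹ : ℝ) * ∫ u, Φ (v, u) ∂μ := by
    intro v
    have h := integral_subordination (r := Real.pi * ‖v‖) (by positivity)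
    have h2 : ∫ u, Φ (v, u) ∂μ = e v * ((∫ u in Ioi (0 : ℝ), u ^ (-(1 / 2) : ℝ) *
        Real.exp (-u - (Real.pi * ‖v‖) ^ 2 / u) : ℝ) : ℂ) := by
      rw [← integral_complex_ofReal, ← integral_const_mul]
      congr 1 with u
      simp only [hΦ]
      rw [mul_assoc, ← Complex.ofReal_mul, mul_left_comm, ← Real.exp_add]
      congr 4
      ring
    rw [h2, h, mul_left_comm, ← Complex.ofReal_mul, ← mul_assoc, inv_mul_cancel₀ (by positivity),
      one_mul, symbol]
    congr 3
    ring
  have hlast : ∀ u ∈ Ioi (0 : ℝ), ∫ v, Φ (v, u) = ((Real.pi ^ (-(d / 2)) *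
      (u ^ ((d + 1) / 2 - 1) * Real.exp (-((1 + ‖x‖ ^ 2) * u))) : ℝ) : ℂ) := by
    intro u hu
    have hu : 0 < u := hu
    simp only [hΦ]
    rw [integral_mul_const, fourierInv_gaussian (by positivity), ← Complex.ofReal_mul,
      show Real.pi / (Real.pi ^ 2 / u) = u / Real.pi by field_simp,
      Real.div_rpow hu.le hpi.le, ← hd, Real.rpow_neg hpi.le,
      show (d + 1) / 2 - 1 = d / 2 + -(1 / 2) by ring, Real.rpow_add hu,
      show -((1 + ‖x‖ ^ 2) * u) = -(Real.pi ^ 2 * ‖x‖ ^ 2 / (Real.pi ^ 2 / u)) + -u by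
        field_simp; ring, Real.exp_add]
    congr 1
    ring
  rw [Real.fourierInv_eq']
  simp only [smul_eq_mul]
  change ∫ v, e v * symbol 1 1 v = _
  simp_rw [hsymb]
  rw [integral_const_mul, integral_integral_swap hΦint,
    setIntegral_congr_fun measurableSet_Ioi hlast, integral_complex_ofReal, integral_const_mul,
    Real.integral_rpow_mul_exp_neg_mul_Ioi (by positivity) (by positivity),
    ← Complex.ofReal_mul, one_div, Real.inv_rpow (by positivity), ← Real.rpow_neg (by positivity),
    Real.sqrt_eq_rpow, ← Real.rpow_neg hpi.le,
    show Real.Gamma ((d + 1) / 2) / Real.pi ^ ((d + 1) / 2) =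
      Real.pi ^ (-(1 / 2) : ℝ) * Real.pi ^ (-(d / 2)) * Real.Gamma ((d + 1) / 2) by
        rw [← Real.rpow_add hpi, div_eq_inv_mul, ← Real.rpow_neg hpi.le]
        congr 2
        ring]
  congr 1
  ring

end Subordination

/-! ### The Poisson kernel -/

section Poisson

variable {E : Type*} [NormedAddCommGroup E] [InnerProductSpace ℝ E]

/-- The profiles at time one of the Poisson kernel and of its first two time derivatives. -/
def poissonProfile (j : ℕ) (z : E) : ℂ :=
  let d : ℝ := Module.finrank ℝ E
  let a : ℝ := (d + 1) / 2
  let q : ℝ := 1 + ‖z‖ ^ 2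
  ((Real.Gamma a / Real.pi ^ a * match j with
    | 0 => q ^ (-a)
    | 1 => q ^ (-a) - (d + 1) * q ^ (-(a + 1))
    | _ => (d + 1) * (-3 * q ^ (-(a + 1)) + (d + 3) * q ^ (-(a + 2))) : ℝ) : ℂ)

omit [InnerProductSpace ℝ E] in
lemma continuous_bracket_rpow (b : ℝ) : Continuous (fun z : E => (1 + ‖z‖ ^ 2) ^ (-b)) :=
  Continuous.rpow_const (by fun_prop) fun z => Or.inl (by positivity)

omit [InnerProductSpace ℝ E] in
lemma bracket_rpow_le {b : ℝ} (hb : 0 ≤ b) (z : E) :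
    (1 + ‖z‖ ^ 2) ^ (-b) ≤ 2 ^ b * (1 + ‖z‖) ^ (-(2 * b)) := by
  have h : (1 + ‖z‖) ^ 2 / 2 ≤ 1 + ‖z‖ ^ 2 := by nlinarith [sq_nonneg (1 - ‖z‖)]
  refine (Real.rpow_le_rpow_of_nonpos (by positivity) h (by linarith)).trans_eq ?_
  rw [Real.div_rpow (by positivity) (by norm_num), ← Real.rpow_natCast, ← Real.rpow_mul
    (by positivity), Real.rpow_neg two_pos.le b, div_inv_eq_mul, mul_comm]
  congr 2
  push_cast
  ring

omit [InnerProductSpace ℝ E] in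
lemma bracket_rpow_anti {b b' : ℝ} (hb : b ≤ b') (z : E) :
    (1 + ‖z‖ ^ 2) ^ (-b') ≤ (1 + ‖z‖ ^ 2) ^ (-b) :=
  Real.rpow_le_rpow_of_exponent_le (by simp) (by linarith)

/-- Writing |z|² = q - 1 with q = 1 + |z|² keeps the radial derivative among powers of q, so the
Euler relation becomes an identity between such powers. -/
lemma hasDerivAt_bracket_dilation (b : ℝ) (z : E) :
    HasDerivAt (fun r : ℝ => (1 + ‖r • z‖ ^ 2) ^ (-b))
      (-2 * b * ((1 + ‖z‖ ^ 2) ^ (-b) - (1 + ‖z‖ ^ 2) ^ (-(b + 1)))) 1 := by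
  have e : ∀ r : ℝ, 1 + ‖r • z‖ ^ 2 = 1 + r ^ 2 * ‖z‖ ^ 2 := fun r => by
    rw [norm_smul, mul_pow, Real.norm_eq_abs, sq_abs]
  simp_rw [e]
  have h1 : HasDerivAt (fun r : ℝ => 1 + r ^ 2 * ‖z‖ ^ 2) (2 * ‖z‖ ^ 2) 1 := by
    simpa using ((hasDerivAt_pow 2 (1 : ℝ)).mul_const (‖z‖ ^ 2)).const_add 1
  have hq : 0 < 1 + ‖z‖ ^ 2 := by positivity
  refine (h1.rpow_const (p := -b) (Or.inl (by positivity))).congr_deriv ?_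
  rw [one_pow, one_mul, show -b = -(b + 1) + 1 by ring, Real.rpow_add_one hq.ne']
  ring_nf

lemma norm_poissonProfile_zero_le (z : E) : ‖poissonProfile 0 z‖ ≤
    Real.Gamma (((Module.finrank ℝ E : ℝ) + 1) / 2) /
      Real.pi ^ (((Module.finrank ℝ E : ℝ) + 1) / 2) *
      (1 + ‖z‖ ^ 2) ^ (-(((Module.finrank ℝ E : ℝ) + 1) / 2)) := by
  have := Real.Gamma_pos_of_pos (s := ((Module.finrank ℝ E : ℝ) + 1) / 2) (by positivity)
  simp only [poissonProfile]
  rw [Complex.norm_real, Real.norm_of_nonneg (by positivity)]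

lemma norm_poissonProfile_one_le (z : E) : ‖poissonProfile 1 z‖ ≤
    Real.Gamma (((Module.finrank ℝ E : ℝ) + 1) / 2) /
      Real.pi ^ (((Module.finrank ℝ E : ℝ) + 1) / 2) * ((Module.finrank ℝ E : ℝ) + 2) *
      (1 + ‖z‖ ^ 2) ^ (-(((Module.finrank ℝ E : ℝ) + 1) / 2)) := by
  set d : ℝ := (Module.finrank ℝ E : ℝ) with hd
  have hd0 : 0 ≤ d := Nat.cast_nonneg _
  have := Real.Gamma_pos_of_pos (s := (d + 1) / 2) (by positivity)
  simp only [poissonProfile, ← hd]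
  rw [Complex.norm_real, norm_mul, Real.norm_of_nonneg (by positivity), mul_assoc]
  gcongr
  have h1 := bracket_rpow_anti (b := (d + 1) / 2) (b' := (d + 1) / 2 + 1) (by linarith) z
  refine (norm_sub_le _ _).trans ?_
  rw [norm_mul, Real.norm_of_nonneg (by positivity), Real.norm_of_nonneg (by positivity),
    Real.norm_of_nonneg (by positivity)]
  nlinarith

/-- In the second time derivative the leading power q^{-(d+1)/2} cancels, so the decay improves from
|z|^{-d-1} to |z|^{-d-3}. This makes the moments of every order α < 2 finite, while the first
derivative only allows α < 1. -/
lemma norm_poissonProfile_two_le (z : E) : ‖poissonProfile 2 z‖ ≤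
    Real.Gamma (((Module.finrank ℝ E : ℝ) + 1) / 2) /
      Real.pi ^ (((Module.finrank ℝ E : ℝ) + 1) / 2) *
      (((Module.finrank ℝ E : ℝ) + 1) * ((Module.finrank ℝ E : ℝ) + 6)) *
      (1 + ‖z‖ ^ 2) ^ (-(((Module.finrank ℝ E : ℝ) + 1) / 2 + 1)) := by
  set d : ℝ := (Module.finrank ℝ E : ℝ) with hd
  have hd0 : 0 ≤ d := Nat.cast_nonneg _
  have := Real.Gamma_pos_of_pos (s := (d + 1) / 2) (by positivity)
  simp only [poissonProfile, ← hd]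
  rw [Complex.norm_real, norm_mul, Real.norm_of_nonneg (by positivity), mul_assoc, norm_mul,
    mul_assoc (d + 1), Real.norm_of_nonneg (show 0 ≤ d + 1 by positivity)]
  gcongr
  have h1 := bracket_rpow_anti (b := (d + 1) / 2 + 1) (b' := (d + 1) / 2 + 2) (by linarith) z
  refine (norm_add_le _ _).trans ?_
  rw [norm_mul, norm_mul, norm_neg, Real.norm_ofNat, Real.norm_of_nonneg (by positivity),
    Real.norm_of_nonneg (by positivity), Real.norm_of_nonneg (by positivity)]
  nlinarith

lemma continuous_poissonProfile (j : ℕ) : Continuous (poissonProfile (E := E) j) := by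
  refine Complex.continuous_ofReal.comp (continuous_const.mul ?_)
  match j with
  | 0 => exact continuous_bracket_rpow _
  | 1 => exact (continuous_bracket_rpow _).sub (continuous_const.mul (continuous_bracket_rpow _))
  | _ + 2 => exact continuous_const.mul ((continuous_const.mul (continuous_bracket_rpow _)).add
      (continuous_const.mul (continuous_bracket_rpow _)))

variable [FiniteDimensional ℝ E] [MeasurableSpace E] [BorelSpace E]

theorem isSemigroupProfile_poisson : IsSemigroupProfile (E := E) 1 poissonProfile where
  order_pos := one_pos
  continuous j _ := continuous_poissonProfile j
  decay := by
    set d : ℝ := (Module.finrank ℝ E : ℝ) with hd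
    have hd0 : 0 ≤ d := Nat.cast_nonneg _
    have := Real.Gamma_pos_of_pos (s := (d + 1) / 2) (by positivity)
    set c := Real.Gamma ((d + 1) / 2) / Real.pi ^ ((d + 1) / 2) with hc
    have hc0 : 0 < c := by positivity
    refine ⟨c * ((d + 1) * (d + 6)) * 2 ^ ((d + 1) / 2), fun j hj z => ?_⟩
    have h1 := bracket_rpow_le (b := (d + 1) / 2) (by positivity) z
    rw [show 2 * ((d + 1) / 2) = d + 1 by ring] at h1
    suffices h : ‖poissonProfile j z‖ ≤
        c * ((d + 1) * (d + 6)) * (1 + ‖z‖ ^ 2) ^ (-((d + 1) / 2)) by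
      refine h.trans ?_
      rw [mul_assoc _ (2 ^ ((d + 1) / 2))]
      gcongr
    interval_cases j
    · refine (norm_poissonProfile_zero_le z).trans ?_
      gcongr
      exact le_mul_of_one_le_right hc0.le (by nlinarith)
    · refine (norm_poissonProfile_one_le z).trans ?_
      gcongr
      nlinarith
    · refine (norm_poissonProfile_two_le z).trans ?_
      gcongr ?_ * ?_
      exact bracket_rpow_anti (by linarith) z
  even j _ z := by simp only [poissonProfile, norm_neg]
  euler j hj z := by
    set d : ℝ := (Module.finrank ℝ E : ℝ) with hd
    set a := (d + 1) / 2 with ha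
    set c := Real.Gamma a / Real.pi ^ a with hc
    have hda : d = 2 * a - 1 := by rw [ha]; ring
    interval_cases j
    · refine ⟨_, ((hasDerivAt_bracket_dilation a z).const_mul c).ofReal_comp, ?_⟩
      simp only [poissonProfile, ← hd, ← ha, ← hc]
      rw [← Complex.ofReal_natCast (Module.finrank ℝ E), ← hd, hda]
      push_cast
      ring
    · refine ⟨_, (((hasDerivAt_bracket_dilation a z).sub
        ((hasDerivAt_bracket_dilation (a + 1) z).const_mul (d + 1))).const_mul c).ofReal_comp, ?_⟩
      simp only [poissonProfile, ← hd, ← ha, ← hc]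
      rw [← Complex.ofReal_natCast (Module.finrank ℝ E), ← hd, hda,
        show a + 1 + 1 = a + 2 by ring]
      push_cast
      ring
  fourierInv_symbol := by
    ext z
    rw [fourierInv_symbol_one]
    rfl
  integral_secondDiff_le := by
    set d : ℝ := (Module.finrank ℝ E : ℝ) with hd
    have hd0 : 0 ≤ d := Nat.cast_nonneg _
    set a := (d + 1) / 2 with ha
    have ha0 : 0 < a := by positivity
    have := Real.Gamma_pos_of_pos ha0
    set c := Real.Gamma a / Real.pi ^ a with hc
    have hc0 : 0 < c := by positivity
    have hdecay : ∀ z : E, (1 + ‖z‖ ^ 2) ^ (-a) ≤ 2 ^ a * (1 + ‖z‖) ^ (-(d + 1)) := fun z => by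
      have := bracket_rpow_le ha0.le z
      rwa [show 2 * a = d + 1 by rw [ha]; ring] at this
    have hint : Integrable (poissonProfile (E := E) 0) := by
      refine ((integrable_one_add_norm (r := d + 1) (by linarith)).const_mul (c * 2 ^ a)).mono'
        (continuous_poissonProfile 0).aestronglyMeasurable (ae_of_all _ fun z => ?_)
      refine (norm_poissonProfile_zero_le z).trans ?_
      rw [mul_assoc]
      gcongr
      exact hdecay z
    -- The second derivative of q^{-a} along y is at most 2a|y|² q^{-a-1} + 4a(a+1) b² q^{-a-2},
    -- where b² ≤ q|y|² by Cauchy–Schwarz; the factor 2^a comes from `hdecay`.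
    refine exists_integral_norm_secondDiff_le (C := c * (a * (4 * (a + 1) + 2)) * 2 ^ a) hint
      fun x y => ?_
    set q : ℝ → ℝ := fun s => 1 + ‖x + s • y‖ ^ 2 with hq
    have hq0 : ∀ s, 0 < q s := fun s => by positivity
    set b : ℝ → ℝ := fun s => inner ℝ (x + s • y) y with hb
    have hl : ∀ s : ℝ, HasDerivAt (fun r : ℝ => x + r • y) y s := fun s => by
      simpa using ((hasDerivAt_id s).smul_const y).const_add x
    have hqd : ∀ s, HasDerivAt q (2 * b s) s := fun s => (hl s).norm_sq.const_add 1
    have hbd : ∀ s, HasDerivAt b (‖y‖ ^ 2) s := fun s => by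
      refine ((hl s).inner ℝ (hasDerivAt_const s y)).congr_deriv ?_
      simp
    refine ⟨fun s => ((c * (2 * b s * (-a) * q s ^ (-a - 1)) : ℝ) : ℂ),
      fun s => ((c * (2 * ‖y‖ ^ 2 * (-a) * q s ^ (-a - 1) + 2 * b s * (-a) *
        (2 * b s * (-a - 1) * q s ^ (-a - 1 - 1))) : ℝ) : ℂ), fun s => ⟨?_, ?_, ?_⟩⟩
    · exact (((hqd s).rpow_const (p := -a) (Or.inl (hq0 s).ne')).const_mul c).ofReal_comp
    · exact (((((hbd s).const_mul 2).mul_const (-a)).mul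
        ((hqd s).rpow_const (p := -a - 1) (Or.inl (hq0 s).ne'))).const_mul c).ofReal_comp
    · have h1 : b s ^ 2 ≤ q s * ‖y‖ ^ 2 := by
        have := abs_real_inner_le_norm (x + s • y) y
        calc b s ^ 2 = |b s| ^ 2 := (sq_abs _).symm
          _ ≤ (‖x + s • y‖ * ‖y‖) ^ 2 := by gcongr
          _ ≤ q s * ‖y‖ ^ 2 := by
            rw [mul_pow]
            gcongr
            simp [hq]
      have h2 : q s ^ (-a - 1) ≤ q s ^ (-a) :=
        Real.rpow_le_rpow_of_exponent_le (by simp [hq]) (by linarith)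
      have h3 : q s ^ (-a - 1) = q s ^ (-a - 1 - 1) * q s := by
        rw [← Real.rpow_add_one (hq0 s).ne']
        congr 1
        ring
      set Q := q s ^ (-a - 1 - 1) with hQ
      have hQ0 : 0 < Q := Real.rpow_pos_of_pos (hq0 s) _
      rw [Complex.norm_real, norm_mul, Real.norm_of_nonneg hc0.le]
      have h4 : ‖2 * ‖y‖ ^ 2 * (-a) * q s ^ (-a - 1) + 2 * b s * (-a) *
          (2 * b s * (-a - 1) * Q)‖ ≤ a * (4 * (a + 1) + 2) * ‖y‖ ^ 2 * q s ^ (-a - 1) := by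
        rw [h3, Real.norm_eq_abs, abs_le]
        have p1 : 0 ≤ a * (a + 1) * Q * (q s * ‖y‖ ^ 2 - b s ^ 2) :=
          mul_nonneg (by positivity) (by linarith)
        have p2 : 0 ≤ a * (a + 1) * Q * b s ^ 2 := by positivity
        have p3 : 0 ≤ a * ‖y‖ ^ 2 * (Q * q s) := by
          have := hq0 s
          positivity
        have p4 : 0 ≤ a * (a + 1) * ‖y‖ ^ 2 * (Q * q s) := by
          have := hq0 s
          positivity
        constructor <;> nlinarith
      calc c * _ ≤ c * (a * (4 * (a + 1) + 2) * ‖y‖ ^ 2 *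
            (2 ^ a * (1 + ‖x + s • y‖) ^ (-(d + 1)))) := by
            gcongr
            refine h4.trans ?_
            gcongr
            exact h2.trans (hdecay _)
        _ = _ := by ring

lemma integrable_poissonProfile_one_mul_rpow {α : ℝ} (hα : 0 ≤ α) (hα1 : α < 1) :
    Integrable (fun z : E => ‖poissonProfile 1 z‖ * ‖z‖ ^ α) := by
  set d : ℝ := (Module.finrank ℝ E : ℝ) with hd
  have hΓ := Real.Gamma_pos_of_pos (s := (d + 1) / 2) (by positivity)
  refine integrable_norm_mul_rpow (C := Real.Gamma ((d + 1) / 2) / Real.pi ^ ((d + 1) / 2) *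
    (d + 2) * 2 ^ ((d + 1) / 2)) (continuous_poissonProfile 1) (fun z =>
    (norm_poissonProfile_one_le z).trans ?_) hα (r := 2 * ((d + 1) / 2)) (by linarith)
  rw [mul_assoc _ (2 ^ _)]
  gcongr
  exact bracket_rpow_le (by positivity) z

lemma integrable_poissonProfile_two_mul_rpow {α : ℝ} (hα : 0 ≤ α) (hα2 : α < 2) :
    Integrable (fun z : E => ‖poissonProfile 2 z‖ * ‖z‖ ^ α) := by
  set d : ℝ := (Module.finrank ℝ E : ℝ) with hd
  have hΓ := Real.Gamma_pos_of_pos (s := (d + 1) / 2) (by positivity)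
  refine integrable_norm_mul_rpow (C := Real.Gamma ((d + 1) / 2) / Real.pi ^ ((d + 1) / 2) *
    ((d + 1) * (d + 6)) * 2 ^ ((d + 1) / 2 + 1)) (continuous_poissonProfile 2) (fun z =>
    (norm_poissonProfile_two_le z).trans ?_) hα (r := 2 * ((d + 1) / 2 + 1)) (by linarith)
  rw [mul_assoc _ (2 ^ _)]
  gcongr
  exact bracket_rpow_le (by positivity) z

end Poisson

/-! ### Best constants against the Zygmund seminorm -/

section Comparison

lemma eLpNorm_top_le_ofReal_iff {Ω : Type*} [MeasurableSpace Ω] {μ : Measure Ω} {g : Ω → ℂ} {c : ℝ}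
    (hc : 0 ≤ c) : eLpNorm g ∞ μ ≤ ENNReal.ofReal c ↔ ∀ᵐ x ∂μ, ‖g x‖ ≤ c := by
  rw [eLpNorm_exponent_top]
  refine ⟨fun h => ?_, eLpNormEssSup_le_of_ae_bound⟩
  filter_upwards [ae_le_eLpNormEssSup (f := g) (μ := μ)] with x hx
  have := hx.trans h
  rwa [← ofReal_norm, ENNReal.ofReal_le_ofReal_iff hc] at this

lemma ae_norm_le_of_memLp_top {Ω : Type*} [MeasurableSpace Ω] {μ : Measure Ω} {f : Ω → ℂ}
    (hf : MemLp f ∞ μ) : ∀ᵐ x ∂μ, ‖f x‖ ≤ (eLpNorm f ∞ μ).toReal := by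
  rw [← eLpNorm_top_le_ofReal_iff ENNReal.toReal_nonneg, ENNReal.ofReal_toReal hf.eLpNorm_ne_top]

lemma exists_timeDerivBound_iff {n : ℕ} (u : ℝ → EuclideanSpace ℝ (Fin n) → ℂ) (k : ℕ) (γ : ℝ) :
    (∃ C, TimeDerivBound u k γ C) ↔ bestConstant u k γ < ∞ := by
  simp [bestConstant, iInf_lt_iff]

variable {n : ℕ} {m : ℕ} {ψ : ℕ → EuclideanSpace ℝ (Fin n) → ℂ}
  {f : EuclideanSpace ℝ (Fin n) → ℂ} {u : ℝ → EuclideanSpace ℝ (Fin n) → ℂ} {k : ℕ}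

lemma iteratedDeriv_semigroup (hψ : IsSemigroupProfile m ψ) (hk : k = 1 ∨ k = 2)
    (hf : MemLp f ∞ volume) (hu : ∀ t, 0 < t → u t = kernelConv (dilatedKernel m ψ 0 t) f)
    {t : ℝ} (ht : 0 < t) (x : EuclideanSpace ℝ (Fin n)) :
    iteratedDeriv k (fun s => u s x) t = kernelConv (dilatedKernel m ψ k t) f x := by
  have hB := ae_norm_le_of_memLp_top hf
  have h1 : ∀ s, 0 < s → deriv (fun s => u s x) s = kernelConv (dilatedKernel m ψ 1 s) f x := by
    intro s hs
    refine ((hψ.hasDerivAt_kernelConv zero_lt_two hf.1 hB hs x).congr_of_eventuallyEq ?_).deriv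
    filter_upwards [lt_mem_nhds hs] with r hr
    rw [hu r hr]
  rcases hk with rfl | rfl
  · rw [iteratedDeriv_one, h1 t ht]
  · rw [iteratedDeriv_succ, iteratedDeriv_one]
    refine ((hψ.hasDerivAt_kernelConv one_lt_two hf.1 hB ht x).congr_of_eventuallyEq ?_).deriv
    filter_upwards [lt_mem_nhds ht] with r hr using h1 r hr

lemma timeDerivBound_iff (hψ : IsSemigroupProfile m ψ) (hk : k = 1 ∨ k = 2)
    (hf : MemLp f ∞ volume) (hu : ∀ t, 0 < t → u t = kernelConv (dilatedKernel m ψ 0 t) f)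
    (γ : ℝ) (C : ℝ≥0) : TimeDerivBound u k γ C ↔
      ∀ t, 0 < t → ∀ᵐ x, ‖kernelConv (dilatedKernel m ψ k t) f x‖ ≤ C * t ^ (-(k : ℝ) + γ) := by
  refine forall₂_congr fun t ht => ?_
  rw [eLpNorm_top_le_ofReal_iff (by positivity)]
  simp_rw [iteratedDeriv_semigroup hψ hk hf hu ht]

lemma zygmundSeminorm_le_iff {α : ℝ} {N : ℝ≥0} : zygmundSeminorm α f ≤ N ↔
    ∀ y ≠ 0, ∀ᵐ x, ‖secondDiff y f x‖ ≤ N * ‖y‖ ^ α := by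
  simp only [zygmundSeminorm, iSup_le_iff, norm_pos_iff]
  refine forall₂_congr fun y hy => ?_
  have hp : 0 < ‖y‖ ^ α := Real.rpow_pos_of_pos (norm_pos_iff.2 hy) _
  rw [← eLpNorm_top_le_ofReal_iff (by positivity), ENNReal.ofReal_mul N.coe_nonneg,
    ENNReal.ofReal_coe_nnreal, ENNReal.div_le_iff (by simpa using hp) ENNReal.ofReal_ne_top]
  rfl

/-- The best constant in the time derivative bound is comparable to the Zygmund seminorm. -/
theorem bestConstant_comparable_zygmundSeminorm (hψ : IsSemigroupProfile m ψ)
    (hk : k = 1 ∨ k = 2) {α : ℝ} (hα : 0 < α) (hα2 : α < 2)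
    (hint : Integrable (fun z => ‖ψ k z‖ * ‖z‖ ^ α))
    {U : (EuclideanSpace ℝ (Fin n) → ℂ) → ℝ → EuclideanSpace ℝ (Fin n) → ℂ}
    (hU : ∀ f t, 0 < t → U f t = kernelConv (dilatedKernel m ψ 0 t) f) :
    ∃ K : ℝ≥0, 1 ≤ K ∧ ∀ f, MemLp f ∞ volume →
      Comparable K (bestConstant (U f) k (α / m)) (zygmundSeminorm α f) := by
  obtain ⟨Q₁, hQ₁, h₁⟩ := hψ.second_deriv_bound_of_first (α / m)
  obtain ⟨Q₂, hQ₂, h₂⟩ := hψ.ae_norm_secondDiff_le_of_kernelConv hα hα2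
  set J := (∫ z, ‖ψ k z‖ * ‖z‖ ^ α) / 2 with hJ
  have hJ0 : 0 ≤ J := div_nonneg (integral_nonneg fun z => by positivity) two_pos.le
  -- The factor Q₁ + 1 covers both orders: Q₁ is the price of passing from k = 1 to k = 2, and 1
  -- suffices if k = 2 already. The condition 1 ≤ K serves the later addition of ‖f‖_∞.
  obtain ⟨K, hK1, hKJ, hKQ⟩ : ∃ K : ℝ≥0, 1 ≤ K ∧ J ≤ K ∧ Q₂ * (Q₁ + 1) ≤ K := by
    have hQ : 0 ≤ Q₂ * (Q₁ + 1) := by positivity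
    have h : ((1 + J + Q₂ * (Q₁ + 1)).toNNReal : ℝ) = 1 + J + Q₂ * (Q₁ + 1) :=
      Real.coe_toNNReal _ (by positivity)
    refine ⟨(1 + J + Q₂ * (Q₁ + 1)).toNNReal, ?_, ?_, ?_⟩
    · rw [← NNReal.coe_le_coe, h, NNReal.coe_one]
      linarith
    all_goals rw [h]; linarith
  have hK0 : K ≠ 0 := (zero_lt_one.trans_le hK1).ne'
  refine ⟨K, hK1, fun f hf => ⟨?_, ?_⟩⟩
  · have hB := ae_norm_le_of_memLp_top hf
    rcases eq_or_ne (zygmundSeminorm α f) ∞ with h | h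
    · rw [h, ENNReal.mul_top (by simpa using hK0)]
      exact le_top
    · lift zygmundSeminorm α f to ℝ≥0 using h with N hN
      have hN' := zygmundSeminorm_le_iff.1 hN.ge
      have hb : TimeDerivBound (U f) k (α / m) (K * N) := by
        rw [timeDerivBound_iff hψ hk hf (hU f)]
        intro t ht
        filter_upwards [hψ.ae_norm_kernelConv_le_of_secondDiff hk hint hf.1 hB N.coe_nonneg hN' ht]
          with x hx
        refine hx.trans ?_
        rw [NNReal.coe_mul]
        gcongr
      rw [← ENNReal.coe_mul]
      exact iInf₂_le (K * N) hb
  · have hB := ae_norm_le_of_memLp_top hf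
    have key : ∀ C : ℝ≥0, TimeDerivBound (U f) k (α / m) C → zygmundSeminorm α f ≤ K * C := by
      intro C hC
      rw [timeDerivBound_iff hψ hk hf (hU f)] at hC
      have hC2 : ∀ t, 0 < t → ∀ᵐ x, ‖kernelConv (dilatedKernel m ψ 2 t) f x‖ ≤
          (Q₁ + 1) * C * t ^ (-2 + α / m) := by
        rcases hk with rfl | rfl
        · intro t ht
          refine ae_of_all _ fun x => (h₁ f _ C hf.1 hB (by simpa using hC) t ht x).trans ?_
          gcongr
          linarith
        · intro t ht
          filter_upwards [hC t ht] with x hx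
          refine hx.trans ?_
          push_cast
          gcongr
          exact le_mul_of_one_le_left C.coe_nonneg (by linarith)
      rw [← ENNReal.coe_mul, zygmundSeminorm_le_iff]
      intro y hy
      filter_upwards [h₂ f _ _ hf.1 hB (by positivity) hC2 y hy] with x hx
      refine hx.trans ?_
      rw [NNReal.coe_mul, ← mul_assoc]
      gcongr
    have hdiv : zygmundSeminorm α f / K ≤ bestConstant (U f) k (α / m) :=
      le_iInf₂ fun C hC => ENNReal.div_le_of_le_mul' (key C hC)
    rwa [ENNReal.div_le_iff_le_mul (Or.inl (by simpa using hK0)) (Or.inl ENNReal.coe_ne_top),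
      mul_comm] at hdiv

end Comparison

/-! ### Application to the two semigroups -/

section Concrete

variable {n : ℕ}

lemma biharmonicHeat_eq (f : EuclideanSpace ℝ (Fin n) → ℂ) (t : ℝ) (ht : 0 < t) :
    biharmonicHeat f t = kernelConv (dilatedKernel 4 (fun j => biharmonicProfile j) 0 t) f := by
  rw [isSemigroupProfile_biharmonic.kernel_zero_eq ht]
  rfl

lemma poissonKernel_eq {t : ℝ} (ht : 0 < t) (x : EuclideanSpace ℝ (Fin n)) :
    (poissonKernel t x : ℂ) = dilatedKernel 1 poissonProfile 0 t x := by
  set a : ℝ := ((n : ℝ) + 1) / 2 with ha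
  have h1 : t ^ 2 + ‖x‖ ^ 2 = t ^ 2 * (1 + ‖t⁻¹ • x‖ ^ 2) := by
    rw [norm_smul, Real.norm_of_nonneg (by positivity), mul_pow]
    field_simp
  have h2 : (t ^ 2) ^ a = t ^ (n : ℝ) * t := by
    rw [← Real.rpow_natCast, ← Real.rpow_mul ht.le, ← Real.rpow_add_one ht.ne']
    congr 1
    rw [ha]
    push_cast
    ring
  have h3 : t ^ (n : ℝ) ≠ 0 := (Real.rpow_pos_of_pos ht _).ne'
  have h4 : (1 + ‖t⁻¹ • x‖ ^ 2) ^ a ≠ 0 := (Real.rpow_pos_of_pos (by positivity) _).ne'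
  simp only [poissonKernel, dilatedKernel, poissonProfile, finrank_euclideanSpace_fin, ← ha,
    Nat.cast_one, div_one, Nat.cast_zero, add_zero, Real.rpow_neg_one]
  rw [← Complex.ofReal_mul, h1, Real.mul_rpow (by positivity) (by positivity), h2,
    Real.rpow_neg ht.le, Real.rpow_neg (by positivity)]
  congr 1
  field_simp

lemma poissonSemigroup_eq (f : EuclideanSpace ℝ (Fin n) → ℂ) (t : ℝ) (ht : 0 < t) :
    poissonSemigroup f t = kernelConv (dilatedKernel 1 poissonProfile 0 t) f := by
  ext x
  simp only [poissonSemigroup, kernelConv, poissonKernel_eq ht]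

theorem biharmonicSeminorm_comparable (n : ℕ) {α : ℝ} (hα : 0 < α) (hα2 : α < 2) :
    ∃ K : ℝ≥0, 1 ≤ K ∧ ∀ f : EuclideanSpace ℝ (Fin n) → ℂ, MemLp f ∞ volume →
      Comparable K (biharmonicSeminorm α f) (zygmundSeminorm α f) := by
  have hk : ⌊α / 4⌋₊ = 0 := Nat.floor_eq_zero.2 (by linarith)
  have h := bestConstant_comparable_zygmundSeminorm (n := n) (U := biharmonicHeat)
    isSemigroupProfile_biharmonic (Or.inl rfl) hα hα2
    (integrable_biharmonicProfile_mul_rpow 1 hα.le) biharmonicHeat_eq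
  simpa only [biharmonicSeminorm, hk, zero_add, Nat.cast_ofNat] using h

theorem poissonSeminorm_comparable (n : ℕ) {α : ℝ} (hα : 0 < α) (hα2 : α < 2) :
    ∃ K : ℝ≥0, 1 ≤ K ∧ ∀ f : EuclideanSpace ℝ (Fin n) → ℂ, MemLp f ∞ volume →
      Comparable K (poissonSeminorm α f) (zygmundSeminorm α f) := by
  have main : ∀ k, k = 1 ∨ k = 2 →
      Integrable (fun z : EuclideanSpace ℝ (Fin n) => ‖poissonProfile k z‖ * ‖z‖ ^ α) →
      ∃ K : ℝ≥0, 1 ≤ K ∧ ∀ f : EuclideanSpace ℝ (Fin n) → ℂ, MemLp f ∞ volume →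
        Comparable K (bestConstant (poissonSemigroup f) k α) (zygmundSeminorm α f) := by
    intro k hk hint
    have h := bestConstant_comparable_zygmundSeminorm (n := n) (U := poissonSemigroup)
      isSemigroupProfile_poisson hk hα hα2 hint poissonSemigroup_eq
    simpa only [Nat.cast_one, div_one] using h
  unfold poissonSeminorm
  -- The integer part of α decides the order of the derivative, and that order has exactly the
  -- finite moment required.
  rcases lt_or_ge α 1 with h1 | h1
  · rw [Nat.floor_eq_zero.2 h1]
    exact main 1 (Or.inl rfl) (integrable_poissonProfile_one_mul_rpow hα.le h1)
  · have hk : ⌊α⌋₊ = 1 := (Nat.floor_eq_iff hα.le).2 ⟨by simpa using h1, by norm_num; exact hα2⟩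
    rw [hk]
    exact main 2 (Or.inr rfl) (integrable_poissonProfile_two_mul_rpow hα.le hα2)

lemma add_le_mul_add {K : ℝ≥0} (hK : 1 ≤ K) {a x y : ℝ≥0∞} (h : x ≤ K * y) :
    a + x ≤ K * (a + y) := by
  rw [mul_add]
  gcongr
  exact le_mul_of_one_le_left' (by exact_mod_cast hK)

end Concrete

end BiharmonicLipschitz

end

theorem theorem1p1 (n : ℕ) (hn : 1 ≤ n) (α : ℝ) (hα : 0 < α) (hα2 : α < 2) :
    (∀ f : EuclideanSpace ℝ (Fin n) → ℂ,
      List.TFAE [f ∈ BiharmonicLipschitz.biharmonicLipschitz n α,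
        f ∈ BiharmonicLipschitz.poissonLipschitz n α,
        f ∈ BiharmonicLipschitz.zygmundClass n α]) ∧
    ∃ K : ℝ≥0, ∀ f : EuclideanSpace ℝ (Fin n) → ℂ, MemLp f ∞ volume →
      BiharmonicLipschitz.Comparable K
        (eLpNorm f ∞ volume + BiharmonicLipschitz.biharmonicSeminorm α f)
        (eLpNorm f ∞ volume + BiharmonicLipschitz.poissonSeminorm α f) ∧
      BiharmonicLipschitz.Comparable K
        (eLpNorm f ∞ volume + BiharmonicLipschitz.poissonSeminorm α f)
        (eLpNorm f ∞ volume + BiharmonicLipschitz.zygmundSeminorm α f) := by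
  obtain ⟨K₁, hK₁, h₁⟩ := BiharmonicLipschitz.biharmonicSeminorm_comparable n hα hα2
  obtain ⟨K₂, hK₂, h₂⟩ := BiharmonicLipschitz.poissonSeminorm_comparable n hα hα2
  have finite_iff : ∀ {K : ℝ≥0} {A B : ℝ≥0∞}, BiharmonicLipschitz.Comparable K A B →
      (A < ∞ ↔ B < ∞) := fun h =>
    ⟨fun hA => h.2.trans_lt (ENNReal.mul_lt_top ENNReal.coe_lt_top hA),
      fun hB => h.1.trans_lt (ENNReal.mul_lt_top ENNReal.coe_lt_top hB)⟩
  refine ⟨fun f => ?_, K₁ * K₂, fun f hf => ?_⟩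
  · have e₁ : f ∈ BiharmonicLipschitz.biharmonicLipschitz n α ↔
        f ∈ BiharmonicLipschitz.zygmundClass n α := and_congr_right fun hf =>
      (BiharmonicLipschitz.exists_timeDerivBound_iff _ _ _).trans (finite_iff (h₁ f hf))
    have e₂ : f ∈ BiharmonicLipschitz.poissonLipschitz n α ↔
        f ∈ BiharmonicLipschitz.zygmundClass n α := and_congr_right fun hf =>
      (BiharmonicLipschitz.exists_timeDerivBound_iff _ _ _).trans (finite_iff (h₂ f hf))
    tfae_have 1 ↔ 3 := e₁
    tfae_have 2 ↔ 3 := e₂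
    tfae_finish
  -- Both seminorms are compared with N_α, so comparing them with each other costs the product of
  -- the constants.
  · have hK : 1 ≤ K₁ * K₂ := one_le_mul hK₁ hK₂
    have a₁ : (K₁ : ℝ≥0∞) * K₂ = ((K₁ * K₂ : ℝ≥0) : ℝ≥0∞) := (ENNReal.coe_mul _ _).symm
    have hle : (K₂ : ℝ≥0∞) ≤ ((K₁ * K₂ : ℝ≥0) : ℝ≥0∞) :=
      ENNReal.coe_le_coe.2 (le_mul_of_one_le_left' hK₁)
    refine ⟨⟨?_, ?_⟩, ?_, ?_⟩ <;> apply BiharmonicLipschitz.add_le_mul_add hK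
    · calc _ ≤ (K₁ : ℝ≥0∞) * (K₂ * BiharmonicLipschitz.poissonSeminorm α f) :=
            (h₁ f hf).1.trans (by gcongr; exact (h₂ f hf).2)
        _ = _ := by rw [← mul_assoc, a₁]
    · calc _ ≤ (K₂ : ℝ≥0∞) * (K₁ * BiharmonicLipschitz.biharmonicSeminorm α f) :=
            (h₂ f hf).1.trans (by gcongr; exact (h₁ f hf).2)
        _ = _ := by rw [← mul_assoc, mul_comm (K₂ : ℝ≥0∞), a₁]
    · exact (h₂ f hf).1.trans (by gcongr)
    · exact (h₂ f hf).2.trans (by gcongr)
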